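/- Let $d\in\mathbb N$, $\Lambda=\mathbb Z^d$, $\Lambda_*=\mathbb Z^d\setminus\{0\}$, and let $|\cdot|$ be the Euclidean norm on vectors and the operator norm on $\mathbb R^{d\times d}$ and on multilinear forms. *Nodal basis function.* Let $\zeta\in W^{1,\infty}(\mathbb R^d;\mathbb R)$ be continuous, nonnegative, even and compactly supported, with $\zeta(0)=1$, $\zeta(\xi)=0$ for $\xi\in\Lambda_*$, and $\sum_{\xi\in\Lambda}(a+b\cdot\xi)\,\zeta(x-\xi)=a+b\cdot x$ for all $a\in\mathbb R$, $b,x\in\mathbb R^d$. Put $\chi_{\xi,\rho}(x)=\int_0^1\zeta(\xi+t\rho-x)\,dt$. *Site energy.* Let $\mathscr D$ be the Banach space of families $g=(g_\rho)_{\rho\in\Lambda_*}$ in $\mathbb R^d$ with $\|g\|_{\mathscr D}=\sup_\rho|g_\rho|/|\rho|<\infty$, let $\kappa>0$ and $\mathscr D_\kappa=\{\|g\|_{\mathscr D}\le\kappa\}$. Let $V:\mathscr D\to\mathbb R\cup\{\pm\infty\}$ satisfy $V(0)=0$; $V$ is finite and $C^k$ on $\mathscr D_\kappa$ for some $k\ge3$;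 $V\big((-g_{-\rho})_\rho\big)=V(g)$ for all $g$; and, for every $g\in\mathscr D_\kappa$, $V(g)=\lim_S V(g\mathbf 1_S)$ along the finite sets $S\subset\Lambda_*$ directed by inclusion, where $g\mathbf 1_S$ agrees with $g$ on $S$ and is $0$ elsewhere. For $\boldsymbol\rho\in\Lambda_*^j$, $1\le j\le k$, let $V_{\boldsymbol\rho}=\partial^jV/\partial g_{\rho_1}\cdots\partial g_{\rho_j}$ on $\mathscr D_\kappa$ and $$m(\boldsymbol\rho)=\prod_{i=1}^j|\rho_i|\,\sup_{g\in\mathscr D_\kappa}\|V_{\boldsymbol\rho}(g)\|,\qquad m_{\rm s}^{(\infty)}(\boldsymbol\rho)=m(\boldsymbol\rho)\Big(\sum_{i=1}^j|\rho_i|\Big)^2 ,$$ and assume $\sum_{\boldsymbol\rho\in\Lambda_*^j}m(\boldsymbol\rho)<\infty$ for $1\le j\le k$. *Stresses.* For $u:\mathbb R^d\to\mathbb R^d$ let $D u(\xi)=(u(\xi+\rho)-u(\xi))_{\rho\in\Lambda_*}$, let $W(\mathsf F)=V((\mathsf F\rho)_{\rho\in\Lambda_*})$ for $|\mathsf F|\le\kappa$,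 and $$\mathsf S^{\rm a}(u;x)=\sum_{\xi\in\Lambda}\sum_{\rho\in\Lambda_*}\big[V_\rho(Du(\xi))\otimes\rho\big]\chi_{\xi,\rho}(x),\qquad \mathsf S^{\rm c}_{i\alpha}(u;x)=\frac{\partial W}{\partial\mathsf F_{i\alpha}}(\nabla u(x)),$$ where derivatives of $V$ and $W$ at boundary points of $\mathscr D_\kappa$ and $\{|\mathsf F|\le\kappa\}$ are taken relative to these sets. **Theorem.** There are constants $C,c>0$ and measurable sets $\nu_{\rho\varsigma}\subset\mathbb R^d$ ($\rho,\varsigma\in\Lambda_*$), depending only on $d$ and $\zeta$, such that $$\nu_{\rho\varsigma}\subset B\big(0,c(|\rho|+|\varsigma|)\big),\qquad -\nu_{\rho\varsigma}=\nu_{\rho\varsigma},\qquad \mathrm{vol}(\nu_{\rho\varsigma})\le C\big(|\rho\times\varsigma|+|\rho|+|\varsigma|\big),$$ where $|\rho\times\varsigma|$ is the area of the parallelogram spanned by $\rho$ and $\varsigma$, and such that the following holds for all $k,\kappa,V$ as above. Let $u\in W^{3,\infty}_{\rm loc}(\mathbb R^d;\mathbb R^d)$ (continuous representative) have $\nabla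 u\in W^{2,\infty}$ and $\|\nabla u\|_{L^\infty}\le\kappa$, and let $x\in\mathbb R^d$. Then $|u(\xi+\rho)-u(\xi)|\le\kappa|\rho|$ for all $\xi\in\Lambda$ and $\rho\in\Lambda_*$, the series for $\mathsf S^{\rm a}(u;x)$ converges absolutely, $u$ is differentiable at $x$ with $|\nabla u(x)|\le\kappa$, $W$ is differentiable at $\nabla u(x)$ relative to $\{|\mathsf F|\le\kappa\}$, and, in the Frobenius norm, $$\big|\mathsf S^{\rm a}(u;x)-\mathsf S^{\rm c}(u;x)\big|\le C\Big(\sum_{\boldsymbol\rho\in\Lambda_*^2}m_{\rm s}^{(\infty)}(\boldsymbol\rho)\,\|\nabla^3u\|_{L^\infty(x+\nu_{\rho_1\rho_2})}+\sum_{\boldsymbol\rho\in\Lambda_*^3}m_{\rm s}^{(\infty)}(\boldsymbol\rho)\,\|\nabla^2u\|_{L^\infty(x+\nu_{\rho_1\rho_2})}\|\nabla^2u\|_{L^\infty(x+\nu_{\rho_1\rho_3})}\Big),$$ where the right-hand side may be $+\infty$. -/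

import Mathlib

set_option maxSynthPendingDepth 3

open MeasureTheory Filter Topology
open scoped ENNReal Pointwise

noncomputable section

namespace CauchyBorn

/-! ### Space, lattice, lattice directions -/

/-- `ℝ^d` with the Euclidean norm. -/
abbrev Space (d : ℕ) : Type := EuclideanSpace ℝ (Fin d)

/-- The lattice `Λ = ℤ^d`. -/
abbrev Site (d : ℕ) : Type := Fin d → ℤ

/-- The lattice directions `Λ_* = ℤ^d \ {0}`. -/
abbrev Dir (d : ℕ) : Type := {ρ : Site d // ρ ≠ 0}

/-- A lattice vector regarded as a point of `ℝ^d`. -/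
def Site.pt {d : ℕ} (ξ : Site d) : Space d := WithLp.toLp 2 (fun i => (ξ i : ℝ))

/-- A lattice direction regarded as a vector of `ℝ^d`. -/
def Dir.vec {d : ℕ} (ρ : Dir d) : Space d := Site.pt ρ.1

/-- The direction `-ρ`. -/
def Dir.opp {d : ℕ} (ρ : Dir d) : Dir d := ⟨-ρ.1, neg_ne_zero.mpr ρ.2⟩

theorem Dir.vec_ne_zero {d : ℕ} (ρ : Dir d) : ρ.vec ≠ 0 := by
  intro h
  apply ρ.2
  funext i
  have h1 := congrArg (fun v : Space d => v i) h
  simpa [Dir.vec, Site.pt] using h1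

/-! ### The space of finite difference stencils -/

/-- The Banach space `𝒟` of stencils `g = (g_ρ)_{ρ ∈ Λ_*}`, `g_ρ ∈ ℝ^d`, with
`‖g‖ = sup_ρ |g_ρ| / |ρ| < ∞`. An element stores the normalised vectors `g_ρ / |ρ|`, so that `𝒟`
is the space of bounded families with the supremum norm; the entries `g_ρ` themselves are
`Stencil.entry g ρ`. -/
abbrev Stencil (d : ℕ) : Type := lp (fun _ : Dir d => Space d) ∞

/-- The entry `g_ρ` of the stencil `g`. -/
def Stencil.entry {d : ℕ} (g : Stencil d) (ρ : Dir d) : Space d := ‖ρ.vec‖ • g ρ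

/-- The norm of `𝒟` is `sup_ρ |g_ρ| / |ρ|`. -/
theorem Stencil.norm_eq {d : ℕ} (g : Stencil d) :
    ‖g‖ = ⨆ ρ : Dir d, ‖Stencil.entry g ρ‖ / ‖ρ.vec‖ := by
  rw [lp.norm_eq_ciSup]
  congr 1
  funext ρ
  have h : ‖ρ.vec‖ ≠ 0 := norm_ne_zero_iff.mpr ρ.vec_ne_zero
  rw [Stencil.entry, norm_smul, norm_norm, mul_div_cancel_left₀ _ h]

open Classical in
/-- The stencil with entries `f ρ`, for a family `f` with `sup_ρ |f ρ| / |ρ| < ∞`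
(the zero stencil for any other family). -/
def Stencil.ofFun {d : ℕ} (f : Dir d → Space d) : Stencil d :=
  if h : Memℓp (fun ρ : Dir d => ‖ρ.vec‖⁻¹ • f ρ) ∞ then ⟨_, h⟩ else 0

theorem Stencil.entry_ofFun {d : ℕ} (f : Dir d → Space d) (C : ℝ)
    (hf : ∀ ρ, ‖f ρ‖ ≤ C * ‖ρ.vec‖) (ρ : Dir d) :
    Stencil.entry (Stencil.ofFun f) ρ = f ρ := by
  have hpos : ∀ ρ : Dir d, 0 < ‖ρ.vec‖ := fun ρ => norm_pos_iff.mpr ρ.vec_ne_zero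
  have h : Memℓp (fun ρ : Dir d => ‖ρ.vec‖⁻¹ • f ρ) ∞ := by
    apply memℓp_infty
    refine ⟨C, ?_⟩
    rintro _ ⟨σ, rfl⟩
    simp only [norm_smul, norm_inv, norm_norm]
    rw [inv_mul_le_iff₀ (hpos σ), mul_comm]
    exact hf σ
  have e : Stencil.ofFun f = ⟨_, h⟩ := dif_pos h
  rw [Stencil.entry, e]
  exact smul_inv_smul₀ (hpos ρ).ne' (f ρ)

/-- The inclusion `ℝ^d → 𝒟` that sends `h` to the stencil whose only non-zero entry is `h`,
in the direction `ρ`. -/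
def Stencil.single {d : ℕ} (ρ : Dir d) : Space d →L[ℝ] Stencil d :=
  LinearMap.toContinuousLinearMap
    (‖ρ.vec‖⁻¹ • lp.lsingle (𝕜 := ℝ) (E := fun _ : Dir d => Space d) ∞ ρ)

theorem Stencil.entry_single {d : ℕ} (ρ σ : Dir d) (h : Space d) :
    Stencil.entry (Stencil.single ρ h) σ = if σ = ρ then h else 0 := by
  by_cases hs : σ = ρ
  · subst hs
    have h0 : ‖σ.vec‖ ≠ 0 := norm_ne_zero_iff.mpr σ.vec_ne_zero
    simp [Stencil.entry, Stencil.single, smul_smul, h0]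
  · simp [Stencil.entry, Stencil.single, hs]

open Classical in
/-- The stencil that agrees with `g` on the finite set `s` of directions and vanishes elsewhere. -/
def Stencil.truncate {d : ℕ} (s : Finset (Dir d)) (g : Stencil d) : Stencil d :=
  Stencil.ofFun (fun ρ => if ρ ∈ s then Stencil.entry g ρ else 0)

/-- `𝒟_κ = {g ∈ 𝒟 : ‖g‖ ≤ κ}`. -/
def stencilBall (d : ℕ) (κ : ℝ) : Set (Stencil d) := Metric.closedBall 0 κ

/-- `Dv(ξ) = (v(ξ + ρ) - v(ξ))_ρ` for a lattice function `v`. -/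
def diffStencil {d : ℕ} (v : Site d → Space d) (ξ : Site d) : Stencil d :=
  Stencil.ofFun (fun ρ => v (ξ + ρ.1) - v ξ)

/-- `F · Λ_* = (F ρ)_ρ` for a matrix `F`. -/
def homStencil {d : ℕ} (F : Space d →L[ℝ] Space d) : Stencil d :=
  Stencil.ofFun (fun ρ => F ρ.vec)

/-! ### The site energy -/

/-- The partial derivative `V_ρ(g) = ∂^j V(g) / ∂g_{ρ_1} ⋯ ∂g_{ρ_j}`, a `j`-linear form on `ℝ^d`,
for `g ∈ 𝒟_κ`. Derivatives are taken relative to the closed ball `𝒟_κ`, since `V` is only known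
to be smooth there. -/
def partialDeriv {d : ℕ} (V : Stencil d → EReal) (κ : ℝ) {j : ℕ} (ρ : Fin j → Dir d)
    (g : Stencil d) : ContinuousMultilinearMap ℝ (fun _ : Fin j => Space d) ℝ :=
  (iteratedFDerivWithin ℝ j (fun g' => (V g').toReal) (stencilBall d κ) g).compContinuousLinearMap
    (fun i => Stencil.single (ρ i))

/-- `m(ρ) = ∏_i |ρ_i| sup_{g ∈ 𝒟_κ} ‖V_ρ(g)‖`. -/
def mBound {d : ℕ} (V : Stencil d → EReal) (κ : ℝ) {j : ℕ} (ρ : Fin j → Dir d) : ℝ≥0∞ :=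
  (∏ i, ‖(ρ i).vec‖ₑ) * ⨆ g ∈ stencilBall d κ, ‖partialDeriv V κ ρ g‖ₑ

/-- The standing assumptions on the site energy `V : 𝒟 → ℝ ∪ {±∞}` and on `κ`: it is an energy
difference, it is `C^k` on `𝒟_κ`, it has inversion symmetry, its derivatives up to order `k`
decay, and its value at a stencil is the limit of its values at the finite truncations
(without which `V` would not be determined by its dependence on the individual entries `g_ρ`). -/
structure IsSiteEnergy {d : ℕ} (V : Stencil d → EReal) (κ : ℝ) (k : ℕ) : Prop where
  zero : V 0 = 0
  finite : ∀ g ∈ stencilBall d κ, V g ≠ ⊥ ∧ V g ≠ ⊤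
  smooth : ContDiffOn ℝ (k : WithTop ℕ∞) (fun g => (V g).toReal) (stencilBall d κ)
  symm : ∀ g g' : Stencil d,
    (∀ ρ, Stencil.entry g' ρ = -Stencil.entry g (Dir.opp ρ)) → V g' = V g
  decay : ∀ j : ℕ, 1 ≤ j → j ≤ k → ∑' ρ : Fin j → Dir d, mBound V κ ρ < ∞
  truncation : ∀ g ∈ stencilBall d κ,
    Tendsto (fun s : Finset (Dir d) => V (Stencil.truncate s g)) atTop (𝓝 (V g))

/-- `|a × b|`, the area of the parallelogram spanned by `a` and `b`. -/
def crossNorm {d : ℕ} (a b : Space d) : ℝ :=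
  Real.sqrt (‖a‖ ^ 2 * ‖b‖ ^ 2 - (inner ℝ a b) ^ 2)

/-- `m_s^{(p)}(ρ) = m(ρ) |ρ|² (∑_{i = 2}^j (|ρ_1 × ρ_i| + |ρ_1| + |ρ_i|))^{1/((j - 1) p)}`, where
`|ρ| = ∑_i |ρ_i|`, for `ρ ∈ Λ_*^j` with `j = n + 1`. The exponent is `0` for `p = ∞`. -/
def msBound {d : ℕ} (V : Stencil d → EReal) (κ : ℝ) (p : ℝ≥0∞) {n : ℕ} (ρ : Fin (n + 1) → Dir d) :
    ℝ≥0∞ :=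
  mBound V κ ρ * (∑ i, ‖(ρ i).vec‖ₑ) ^ 2 *
    (ENNReal.ofReal (∑ i : Fin n,
      (crossNorm (ρ 0).vec (ρ i.succ).vec + ‖(ρ 0).vec‖ + ‖(ρ i.succ).vec‖))) ^
      (((n : ℝ≥0∞) * p)⁻¹).toReal

/-! ### Weak derivatives and Sobolev functions -/

/-- `G` is the weak (distributional) gradient of `f` on `ℝ^d`. -/
structure HasWeakGrad {d : ℕ} {F : Type*} [NormedAddCommGroup F] [NormedSpace ℝ F]
    (f : Space d → F) (G : Space d → Space d →L[ℝ] F) : Prop where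
  locInt : LocallyIntegrable f volume
  locInt_grad : LocallyIntegrable G volume
  integral_eq : ∀ φ : Space d → ℝ, ContDiff ℝ ((⊤ : ℕ∞) : WithTop ℕ∞) φ → HasCompactSupport φ →
    ∀ v : Space d, ∫ x, (fderiv ℝ φ x v) • f x = -∫ x, φ x • (G x v)

/-- `u` is (the continuous representative of) an element of the homogeneous Sobolev space
`Ẇ^{3,∞}`, with weak derivatives `∇u = G₁`, `∇²u = G₂`, `∇³u = G₃`. -/
structure IsHomSobolevThree {d : ℕ} (u : Space d → Space d)
    (G₁ : Space d → Space d →L[ℝ] Space d)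
    (G₂ : Space d → Space d →L[ℝ] Space d →L[ℝ] Space d)
    (G₃ : Space d → Space d →L[ℝ] Space d →L[ℝ] Space d →L[ℝ] Space d) : Prop where
  cont : Continuous u
  grad₁ : HasWeakGrad u G₁
  grad₂ : HasWeakGrad G₁ G₂
  grad₃ : HasWeakGrad G₂ G₃
  bdd₁ : MemLp G₁ ∞ volume
  bdd₂ : MemLp G₂ ∞ volume
  bdd₃ : MemLp G₃ ∞ volume

/-! ### The nodal basis function and the localisation weights -/

/-- The assumptions on the nodal basis function `ζ ∈ W^{1,∞}(ℝ^d)`. -/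
structure IsNodalBasis {d : ℕ} (ζ : Space d → ℝ) : Prop where
  cont : Continuous ζ
  bdd : MemLp ζ ∞ volume
  grad : ∃ G : Space d → Space d →L[ℝ] ℝ, HasWeakGrad ζ G ∧ MemLp G ∞ volume
  at_zero : ζ 0 = 1
  at_lattice : ∀ ξ : Site d, ξ ≠ 0 → ζ (Site.pt ξ) = 0
  nonneg : ∀ x, 0 ≤ ζ x
  compact : HasCompactSupport ζ
  even : ∀ x, ζ (-x) = ζ x
  affine : ∀ (a : ℝ) (b x : Space d),
    ∑' ξ : Site d, (a + inner ℝ b (Site.pt ξ)) * ζ (x - Site.pt ξ) = a + inner ℝ b x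

/-- `χ_{ξ,ρ}(x) = ∫_0^1 ζ(ξ + tρ - x) dt`. -/
def chi {d : ℕ} (ζ : Space d → ℝ) (ξ : Site d) (ρ : Dir d) (x : Space d) : ℝ :=
  ∫ t in (0 : ℝ)..1, ζ (Site.pt ξ + t • ρ.vec - x)

/-! ### The two stresses -/

/-- The `i`-th unit vector of `ℝ^d`. -/
def unitVec {d : ℕ} (i : Fin d) : Space d := EuclideanSpace.single i 1

/-- The values of `u` on the lattice. -/
def onLattice {d : ℕ} (u : Space d → Space d) : Site d → Space d := fun ξ => u (Site.pt ξ)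

/-- The `(i, α)` component of `[Φ_{ξ,ρ}(u) ⊗ ρ] χ_{ξ,ρ}(x)`, where `Φ_{ξ,ρ}(u) = V_ρ(Du(ξ))`. -/
def atomStressTerm {d : ℕ} (ζ : Space d → ℝ) (V : Stencil d → EReal) (κ : ℝ)
    (u : Space d → Space d) (x : Space d) (i α : Fin d) (q : Site d × Dir d) : ℝ :=
  partialDeriv V κ (fun _ : Fin 1 => q.2) (diffStencil (onLattice u) q.1) (fun _ => unitVec i) *
    q.2.vec α * chi ζ q.1 q.2 x

/-- The atomistic stress `S^a(u; x) = ∑_ξ ∑_ρ [Φ_{ξ,ρ}(u) ⊗ ρ] χ_{ξ,ρ}(x)`. -/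
def atomStress {d : ℕ} (ζ : Space d → ℝ) (V : Stencil d → EReal) (κ : ℝ)
    (u : Space d → Space d) (x : Space d) : Matrix (Fin d) (Fin d) ℝ :=
  Matrix.of fun i α => ∑' q : Site d × Dir d, atomStressTerm ζ V κ u x i α q

/-- The Cauchy--Born stored energy density `W(F) = V(F · Λ_*)`. -/
def cbEnergy {d : ℕ} (V : Stencil d → EReal) (F : Space d →L[ℝ] Space d) : EReal :=
  V (homStencil F)

/-- The set `{F : |F| ≤ κ}` of matrices on which `W` is differentiable. -/
def gradBall (d : ℕ) (κ : ℝ) : Set (Space d →L[ℝ] Space d) := Metric.closedBall 0 κ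

/-- The matrix with the single non-zero component `1` at `(i, α)`. -/
def unitMat {d : ℕ} (i α : Fin d) : Space d →L[ℝ] Space d :=
  (EuclideanSpace.proj α : Space d →L[ℝ] ℝ).smulRight (unitVec i)

/-- The Cauchy--Born (first Piola--Kirchhoff) stress `S^c_{iα}(u; x) = ∂W/∂F_{iα}(∇u(x))`. -/
def cbStress {d : ℕ} (V : Stencil d → EReal) (κ : ℝ)
    (u : Space d → Space d) (x : Space d) : Matrix (Fin d) (Fin d) ℝ :=
  Matrix.of fun i α =>
    fderivWithin ℝ (fun F => (cbEnergy V F).toReal) (gradBall d κ) (fderiv ℝ u x) (unitMat i α)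

/-- The Frobenius norm of a matrix. -/
def matNorm {d : ℕ} (S : Matrix (Fin d) (Fin d) ℝ) : ℝ := Real.sqrt (∑ i, ∑ α, S i α ^ 2)

/-- `‖f‖_{L^∞(s)}`. -/
def supNormOn {d : ℕ} {F : Type*} [NormedAddCommGroup F] (f : Space d → F) (s : Set (Space d)) :
    ℝ≥0∞ :=
  eLpNorm f ∞ (volume.restrict s)

end CauchyBorn

end

open CauchyBorn

/-!
The proof rests on three facts.

*The energy is governed by its partial derivatives.* The derivative of `V` is a functional on a
space of bounded families, so it may have a part at infinity that the partial derivatives `V_ρ` do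
not see. The limit of `V` along finite truncations excludes this: the Taylor estimate for
truncated stencils has constants that do not depend on the truncation, because the second partial
derivatives are summable, and the partial derivatives themselves converge along truncations, being
uniform limits of difference quotients (`TruncContinuous.derivAlong_single`,
`TruncContinuous.abs_sub_sub_tsum_le`). Applied to `V` this gives the derivative of the stored
energy density, `∂W(F) = ∑_ρ V_ρ(F · Λ_*) ⊗ ρ` (`hasFDerivWithinAt_cbEnergy`); applied to `V_ρ` it
gives the expansion of `V_ρ(Du(ξ))` about `F · Λ_*` with `F = ∇u(x)`, up to a quadratic remainder
(`abs_partialDeriv_sub_le`).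

*The weights have the right moments.* As `ζ` reproduces affine functions,
`∑_ξ χ_{ξ,ρ}(x) = 1` and `∑_ξ χ_{ξ,ρ}(x) (ξ - x) = -ρ / 2`
(`IsNodalBasis.exists_finset_chi`). Hence the difference of the stresses is the sum over `ρ` and `σ`
of `V_{ρσ}(F · Λ_*)` applied to the weighted mean over `ξ` of `D_σ u(ξ) - F σ`, plus the quadratic
remainder. The mean equals `∇²u(x)[σ - ρ, σ] / 2` up to third derivatives of `u`. This contributes a
term that is odd under `(ρ, σ) ↦ (-ρ, -σ)`, while `V_{ρσ}(F · Λ_*)` is even by inversion symmetry,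
so the two contributions cancel (`enorm_tsum_hessForm_le`). The cancellation has to be made for each
pair before summing: the odd terms alone need not be summable.

*Everything happens near a parallelogram.* If `χ_{ξ,ρ}(x) ≠ 0`, then `ξ` is within a fixed distance
of the segment from `x` to `x - ρ`, so that `x`, `ξ` and `ξ + σ` lie in a convex neighbourhood of the
parallelogram `{x + a ρ + b σ : |a|, |b| ≤ 1}`. This neighbourhood, slightly enlarged, is `x + ν_{ρσ}`,
and the volume bound follows by covering it with balls centred at a grid of bounded mesh size in the
parallelogram (`volume_parNhd_le`).
The Taylor expansions of `u` (`IsHomSobolevThree.exists_taylor`) use that `u` is twice continuously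
differentiable, with a second derivative that is Lipschitz on convex sets with the constant
`‖∇³u‖_{L^∞}` of a neighbourhood; both follow by mollification.
-/

namespace CauchyBorn

/-! ### Directional derivatives relative to a convex set -/

section DerivAlong

variable {E : Type*} [NormedAddCommGroup E] [NormedSpace ℝ E] {K : Set E} {f : E → ℝ}

/-- The derivative of `f` in the direction `v`, relative to the set `K`. -/
noncomputable def derivAlong (K : Set E) (v : E) (f : E → ℝ) : E → ℝ :=
  fun p => fderivWithin ℝ f K p v

theorem derivAlong_contDiffOn (hK : UniqueDiffOn ℝ K) {n m : WithTop ℕ∞} (hf : ContDiffOn ℝ n f K)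
    (hmn : m + 1 ≤ n) (v : E) : ContDiffOn ℝ m (derivAlong K v f) K :=
  (hf.fderivWithin hK hmn).clm_apply contDiffOn_const

theorem derivAlong_congr {f₁ : E → ℝ} (h : ∀ q ∈ K, f q = f₁ q) {p : E} (hp : p ∈ K) (v : E) :
    derivAlong K v f p = derivAlong K v f₁ p := by
  unfold derivAlong
  rw [fderivWithin_congr h (h p hp)]

theorem derivAlong_comm (hK : Convex ℝ K) (hK' : (interior K).Nonempty)
    (hf : ContDiffOn ℝ 2 f K) {p : E} (hp : p ∈ K) (v w : E) :
    derivAlong K v (derivAlong K w f) p = derivAlong K w (derivAlong K v f) p := by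
  have hU := uniqueDiffOn_convex hK hK'
  have hd : DifferentiableWithinAt ℝ (fderivWithin ℝ f K) K p :=
    ((hf.fderivWithin hU (m := 1) (by norm_num)).differentiableOn (by norm_num)) p hp
  have key : ∀ v w : E, derivAlong K v (derivAlong K w f) p =
      fderivWithin ℝ (fderivWithin ℝ f K) K p v w := by
    intro v w
    unfold derivAlong
    rw [fderivWithin_clm_apply (hU p hp) hd (differentiableWithinAt_const _)]
    simp
  rw [key, key]
  have hcl : p ∈ closure (interior K) := by
    rw [hK.closure_interior_eq_closure_of_nonempty_interior hK']
    exact subset_closure hp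
  exact (hf p hp).isSymmSndFDerivWithinAt (by simp) hU hcl hp v w

theorem iteratedFDerivWithin_one_eq_derivAlong (hK : UniqueDiffOn ℝ K) {p : E} (hp : p ∈ K)
    (m : Fin 1 → E) : iteratedFDerivWithin ℝ 1 f K p m = derivAlong K (m 0) f p :=
  iteratedFDerivWithin_one_apply (hK p hp) m

theorem iteratedFDerivWithin_succ_eq_derivAlong (hK : UniqueDiffOn ℝ K) {n : ℕ}
    (hf : ContDiffOn ℝ (n + 1) f K) {p : E} (hp : p ∈ K) (m : Fin (n + 1) → E) :
    iteratedFDerivWithin ℝ (n + 1) f K p m =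
      derivAlong K (m 0) (fun q => iteratedFDerivWithin ℝ n f K q (Fin.tail m)) p := by
  rw [iteratedFDerivWithin_succ_apply_left]
  have hd : DifferentiableWithinAt ℝ (iteratedFDerivWithin ℝ n f K) K p :=
    hf.differentiableOn_iteratedFDerivWithin (by exact_mod_cast Nat.lt_succ_self n) hK p hp
  unfold derivAlong
  let ev : ContinuousMultilinearMap ℝ (fun _ : Fin n => E) ℝ →L[ℝ] ℝ :=
    ContinuousMultilinearMap.apply ℝ (fun _ : Fin n => E) ℝ (Fin.tail m)
  have := (ev.hasFDerivAt.comp_hasFDerivWithinAt p hd.hasFDerivWithinAt).fderivWithin (hK p hp)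
  have e2 : (fun q => iteratedFDerivWithin ℝ n f K q (Fin.tail m)) =
      ev ∘ iteratedFDerivWithin ℝ n f K := rfl
  rw [e2, this]
  rfl

/-- Second-order Taylor estimate on a convex set, in terms of the second derivative along the
segment. -/
theorem abs_sub_sub_derivAlong_le (hK : Convex ℝ K) (hU : UniqueDiffOn ℝ K)
    (hf : ContDiffOn ℝ 2 f K) {g h : E} (hg : g ∈ K) (hh : h ∈ K) {B : ℝ}
    (hB : ∀ p ∈ K, |derivAlong K (g - h) (derivAlong K (g - h) f) p| ≤ B) :
    |f g - f h - derivAlong K (g - h) f h| ≤ B := by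
  set v := g - h with hv
  have hmem : ∀ t ∈ Set.Icc (0 : ℝ) 1, h + t • v ∈ K := fun t ht =>
    hK.add_smul_sub_mem hh hg ht
  have hline : ∀ (F : E → ℝ), DifferentiableOn ℝ F K → ∀ t ∈ Set.Icc (0 : ℝ) 1,
      HasDerivWithinAt (fun t : ℝ => F (h + t • v)) (derivAlong K v F (h + t • v))
        (Set.Icc 0 1) t := by
    intro F hF t ht
    have h1 := (hF _ (hmem t ht)).hasFDerivWithinAt
    have h2 : HasDerivWithinAt (fun t : ℝ => h + t • v) v (Set.Icc 0 1) t := by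
      simpa using (((hasDerivAt_id t).smul_const v).const_add h).hasDerivWithinAt
    exact h1.comp_hasDerivWithinAt t h2 (fun s hs => hmem s hs)
  have hf' : ContDiffOn ℝ 1 (derivAlong K v f) K :=
    derivAlong_contDiffOn hU hf (by norm_num) v
  have hconv : Convex ℝ (Set.Icc (0 : ℝ) 1) := convex_Icc 0 1
  have h0 : (0 : ℝ) ∈ Set.Icc (0 : ℝ) 1 := by simp
  have h1 : (1 : ℝ) ∈ Set.Icc (0 : ℝ) 1 := by simp
  have hB0 : 0 ≤ B := (abs_nonneg _).trans (hB h hh)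
  have step : ∀ t ∈ Set.Icc (0 : ℝ) 1,
      ‖derivAlong K v f (h + t • v) - derivAlong K v f h‖ ≤ B := by
    intro t ht
    have := Convex.norm_image_sub_le_of_norm_hasDerivWithin_le
      (hline _ (hf'.differentiableOn (by norm_num)))
      (fun s hs => (by simpa using hB _ (hmem s hs))) hconv h0 ht
    simp only [zero_smul, add_zero, sub_zero, Real.norm_eq_abs] at this
    refine this.trans ?_
    rw [abs_of_nonneg ht.1]
    nlinarith [ht.2]
  have h3 : ∀ t ∈ Set.Icc (0 : ℝ) 1,
      HasDerivWithinAt (fun t : ℝ => f (h + t • v) - t * derivAlong K v f h)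
        (derivAlong K v f (h + t • v) - derivAlong K v f h) (Set.Icc 0 1) t := by
    intro t ht
    have := ((hasDerivAt_id t).mul_const (derivAlong K v f h)).hasDerivWithinAt
      (s := Set.Icc (0 : ℝ) 1)
    exact ((hline f (hf.differentiableOn (by norm_num)) t ht).sub this).congr_deriv (by simp)
  have := Convex.norm_image_sub_le_of_norm_hasDerivWithin_le h3 step hconv h0 h1
  simp only [one_smul, zero_smul, add_zero, one_mul, zero_mul, sub_zero, norm_one, mul_one,
    Real.norm_eq_abs] at this
  have e : h + v = g := by rw [hv]; abel
  rw [e] at this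
  convert this using 2
  ring

end DerivAlong

/-! ### Stencils and their truncations -/

section Stencil

variable {d : ℕ}

namespace Stencil

theorem entry_add (g h : Stencil d) (ρ : Dir d) : entry (g + h) ρ = entry g ρ + entry h ρ := by
  simp [entry]

theorem entry_sub (g h : Stencil d) (ρ : Dir d) : entry (g - h) ρ = entry g ρ - entry h ρ := by
  simp [entry, smul_sub]

theorem entry_zero (ρ : Dir d) : entry (0 : Stencil d) ρ = 0 := by simp [entry]

theorem entry_sum {ι : Type*} (s : Finset ι) (g : ι → Stencil d) (ρ : Dir d) :
    entry (∑ i ∈ s, g i) ρ = ∑ i ∈ s, entry (g i) ρ := by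
  classical
  induction s using Finset.induction_on with
  | empty => simp [entry_zero]
  | insert a s ha ih => rw [Finset.sum_insert ha, Finset.sum_insert ha, entry_add, ih]

theorem ext_entry {g h : Stencil d} (H : ∀ ρ, entry g ρ = entry h ρ) : g = h := by
  apply lp.ext
  funext ρ
  have h0 : ‖ρ.vec‖ ≠ 0 := norm_ne_zero_iff.mpr ρ.vec_ne_zero
  exact smul_right_injective _ h0 (H ρ)

end Stencil

open Stencil

theorem norm_vec_pos (ρ : Dir d) : 0 < ‖ρ.vec‖ := norm_pos_iff.mpr ρ.vec_ne_zero

theorem one_le_norm_vec (ρ : Dir d) : 1 ≤ ‖ρ.vec‖ := by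
  obtain ⟨i, hi⟩ : ∃ i, ρ.1 i ≠ 0 := by
    by_contra! h
    exact ρ.2 (funext h)
  have h1 : (1 : ℝ) ≤ ‖ρ.vec i‖ := by
    have : (1 : ℤ) ≤ |ρ.1 i| := Int.one_le_abs hi
    have h2 : ρ.vec i = (ρ.1 i : ℝ) := rfl
    rw [h2, Real.norm_eq_abs, ← Int.cast_abs]
    exact_mod_cast this
  exact h1.trans (PiLp.norm_apply_le ρ.vec i)

theorem mem_stencilBall_iff {κ : ℝ} (hκ : 0 ≤ κ) {g : Stencil d} :
    g ∈ stencilBall d κ ↔ ∀ ρ, ‖entry g ρ‖ ≤ κ * ‖ρ.vec‖ := by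
  unfold stencilBall
  rw [mem_closedBall_zero_iff]
  have key : ∀ ρ : Dir d, ‖entry g ρ‖ = ‖g ρ‖ * ‖ρ.vec‖ := fun ρ => by
    rw [entry, norm_smul, norm_norm, mul_comm]
  constructor
  · intro h ρ
    rw [key]
    exact mul_le_mul_of_nonneg_right
      ((lp.norm_apply_le_norm ENNReal.top_ne_zero g ρ).trans h) (norm_nonneg _)
  · intro h
    refine lp.norm_le_of_forall_le hκ fun ρ => ?_
    have := h ρ
    rw [key] at this
    exact le_of_mul_le_mul_right this (norm_vec_pos ρ)

theorem norm_entry_le (g : Stencil d) (ρ : Dir d) : ‖entry g ρ‖ ≤ ‖g‖ * ‖ρ.vec‖ :=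
  (mem_stencilBall_iff (norm_nonneg g)).1 (by simp [stencilBall]) ρ

theorem convex_stencilBall (κ : ℝ) : Convex ℝ (stencilBall d κ) := convex_closedBall 0 κ

theorem stencilBall_interior_nonempty {κ : ℝ} (hκ : 0 < κ) :
    (interior (stencilBall d κ)).Nonempty :=
  ⟨0, mem_interior_iff_mem_nhds.2 (Metric.closedBall_mem_nhds 0 hκ)⟩

theorem uniqueDiffOn_stencilBall {κ : ℝ} (hκ : 0 < κ) : UniqueDiffOn ℝ (stencilBall d κ) :=
  uniqueDiffOn_convex (convex_stencilBall κ) (stencilBall_interior_nonempty hκ)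

open Classical in
theorem entry_truncate (s : Finset (Dir d)) (g : Stencil d) (ρ : Dir d) :
    entry (truncate s g) ρ = if ρ ∈ s then entry g ρ else 0 := by
  unfold truncate
  refine entry_ofFun _ ‖g‖ (fun σ => ?_) ρ
  split_ifs
  · exact norm_entry_le g σ
  · simpa using mul_nonneg (norm_nonneg g) (norm_nonneg σ.vec)

theorem truncate_mem {κ : ℝ} (hκ : 0 ≤ κ) (s : Finset (Dir d)) {g : Stencil d}
    (hg : g ∈ stencilBall d κ) : truncate s g ∈ stencilBall d κ := by
  rw [mem_stencilBall_iff hκ] at hg ⊢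
  intro ρ
  rw [entry_truncate]
  split_ifs
  · exact hg ρ
  · simpa using mul_nonneg hκ (norm_nonneg _)

theorem truncate_sub (s : Finset (Dir d)) (g h : Stencil d) :
    truncate s g - truncate s h = ∑ ρ ∈ s, Stencil.single ρ (entry (g - h) ρ) := by
  classical
  refine ext_entry fun ρ => ?_
  rw [entry_sub, entry_truncate, entry_truncate, entry_sum]
  simp only [entry_single, entry_sub]
  rw [Finset.sum_ite_eq]
  split_ifs <;> simp

theorem truncate_add_single {s : Finset (Dir d)} {ρ : Dir d} (hρ : ρ ∈ s) (g : Stencil d)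
    (a : Space d) :
    truncate s (g + Stencil.single ρ a) = truncate s g + Stencil.single ρ a := by
  classical
  refine ext_entry fun σ => ?_
  rw [entry_add, entry_truncate, entry_truncate, entry_add, entry_single]
  by_cases h : σ = ρ
  · subst h; simp [hρ]
  · simp [h]

theorem entry_add_single (g : Stencil d) (ρ σ : Dir d) (a : Space d) :
    entry (g + Stencil.single ρ a) σ = if σ = ρ then entry g ρ + a else entry g σ := by
  rw [entry_add, entry_single]
  split_ifs with h
  · rw [h]
  · simp

/-! ### Functions of a stencil that are determined by their finite truncations -/

/-- `f` takes at each stencil `g` of the ball the limit of its values at the finite truncations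
of `g`. -/
def TruncContinuous (κ : ℝ) (f : Stencil d → ℝ) : Prop :=
  ∀ g ∈ stencilBall d κ, Tendsto (fun s => f (truncate s g)) atTop (𝓝 (f g))

variable {κ : ℝ} {f : Stencil d → ℝ} {b : Dir d → Dir d → ℝ}

theorem derivAlong_sum_smul {ι : Type*} (K : Set (Stencil d)) (s : Finset ι) (v : ι → Stencil d)
    (f : Stencil d → ℝ) (p : Stencil d) :
    derivAlong K (∑ i ∈ s, v i) f p = ∑ i ∈ s, derivAlong K (v i) f p := by
  simp [derivAlong]

/-- Partial derivatives inherit continuity along truncations, provided that the second partial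
derivatives are bounded: the difference quotients then converge uniformly along the truncations. -/
theorem TruncContinuous.derivAlong_single (hκ : 0 < κ) (hf : ContDiffOn ℝ 2 f (stencilBall d κ))
    (ht : TruncContinuous κ f)
    (hb : ∀ p ∈ stencilBall d κ, ∀ σ τ a c,
      |derivAlong (stencilBall d κ) (Stencil.single σ a)
        (derivAlong (stencilBall d κ) (Stencil.single τ c) f) p| ≤ b σ τ * ‖a‖ * ‖c‖)
    (ρ : Dir d) (a : Space d) :
    TruncContinuous κ (derivAlong (stencilBall d κ) (Stencil.single ρ a) f) := by
  set K := stencilBall d κ with hKdef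
  have hKc : Convex ℝ K := convex_stencilBall κ
  have hU : UniqueDiffOn ℝ K := uniqueDiffOn_stencilBall hκ
  intro p hp
  have hpE := (mem_stencilBall_iff hκ.le).1 hp
  -- directions pointing from `p` into the ball
  have inward : ∀ a : Space d, p + Stencil.single ρ a ∈ K →
      Tendsto (fun s => derivAlong K (Stencil.single ρ a) f (truncate s p)) atTop
        (𝓝 (derivAlong K (Stencil.single ρ a) f p)) := by
    intro a ha
    set e := Stencil.single ρ a with he
    set B := b ρ ρ * ‖a‖ * ‖a‖ with hBdef
    have hB0 : 0 ≤ B := (abs_nonneg _).trans (hb p hp ρ ρ a a)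
    have quot : ∀ t : ℝ, 0 < t → t ≤ 1 → ∀ q ∈ K, q + t • e ∈ K →
        |f (q + t • e) - f q - t * derivAlong K e f q| ≤ t ^ 2 * B := by
      intro t ht0 ht1 q hq hqt
      have hlin : ∀ (F : Stencil d → ℝ) (r : Stencil d),
          derivAlong K (t • e) F r = t * derivAlong K e F r := by
        intro F r
        simp [derivAlong]
      have := abs_sub_sub_derivAlong_le hKc hU hf hqt hq (B := t ^ 2 * B) ?_
      · rwa [add_sub_cancel_left, hlin] at this
      · intro r hr
        rw [add_sub_cancel_left]
        have h2 : derivAlong K (t • e) f = derivAlong K (Stencil.single ρ (t • a)) f := by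
          rw [map_smul]
        have h3 : t • e = Stencil.single ρ (t • a) := by rw [map_smul]
        rw [h2, h3]
        refine (hb r hr ρ ρ _ _).trans (le_of_eq ?_)
        rw [norm_smul, Real.norm_eq_abs, abs_of_pos ht0, hBdef]
        ring
    rw [Metric.tendsto_atTop]
    intro ε hε
    -- a step `t` for which the difference quotients are within `ε / 4` of the derivatives
    obtain ⟨t, ht0, ht1, htε⟩ : ∃ t : ℝ, 0 < t ∧ t ≤ 1 ∧ t * B * 2 < ε / 2 := by
      refine ⟨min 1 (ε / (8 * (B + 1))), by positivity, min_le_left _ _, ?_⟩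
      have : min 1 (ε / (8 * (B + 1))) ≤ ε / (8 * (B + 1)) := min_le_right _ _
      have h8 : 0 < 8 * (B + 1) := by positivity
      have h9 : min 1 (ε / (8 * (B + 1))) * (8 * (B + 1)) ≤ ε := by
        rwa [le_div_iff₀ h8] at this
      have h10 : 0 < min 1 (ε / (8 * (B + 1))) := by positivity
      nlinarith
    have hpt : p + t • e ∈ K := by
      have := hKc.add_smul_sub_mem hp ha ⟨ht0.le, ht1⟩
      simpa using this
    have lim : Tendsto (fun s => f (truncate s (p + t • e)) - f (truncate s p)) atTop
        (𝓝 (f (p + t • e) - f p)) := (ht _ hpt).sub (ht _ hp)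
    rw [Metric.tendsto_atTop] at lim
    obtain ⟨S, hS⟩ := lim (t * (ε / 2)) (by positivity)
    classical
    refine ⟨S ∪ {ρ}, fun s hs => ?_⟩
    have hρs : ρ ∈ s := hs (by simp)
    have h1 : |(f (truncate s (p + t • e)) - f (truncate s p)) - (f (p + t • e) - f p)|
        < t * (ε / 2) := by
      have := hS s (Finset.subset_union_left.trans hs)
      rwa [Real.dist_eq] at this
    have htr : truncate s (p + t • e) = truncate s p + t • e := by
      rw [he, ← map_smul]
      exact truncate_add_single hρs _ _
    have h2 := quot t ht0 ht1 _ hp hpt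
    have h3 := quot t ht0 ht1 _ (truncate_mem hκ.le s hp)
      (by rw [← htr]; exact truncate_mem hκ.le s hpt)
    rw [htr] at h1
    rw [Real.dist_eq]
    have h4 : t * |derivAlong K e f (truncate s p) - derivAlong K e f p| < t * ε := by
      rw [← abs_of_pos ht0, ← abs_mul, abs_of_pos ht0, abs_lt]
      rw [abs_lt] at h1
      rw [abs_le] at h2 h3
      constructor <;> nlinarith
    exact lt_of_mul_lt_mul_left h4 ht0.le
  -- a multiple of any `a` is the difference of two such directions
  obtain ⟨ε, hε, hεa⟩ : ∃ ε : ℝ, 0 < ε ∧ ‖ε • a‖ ≤ κ * ‖ρ.vec‖ := by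
    have hr : 0 < κ * ‖ρ.vec‖ := mul_pos hκ (norm_vec_pos ρ)
    refine ⟨κ * ‖ρ.vec‖ / (‖a‖ + 1), by positivity, ?_⟩
    rw [norm_smul, Real.norm_eq_abs, abs_of_pos (by positivity), div_mul_eq_mul_div,
      div_le_iff₀ (by positivity)]
    nlinarith [norm_nonneg a]
  have hin : ∀ a' : Space d, ‖a'‖ ≤ κ * ‖ρ.vec‖ →
      p + Stencil.single ρ (a' - entry p ρ) ∈ K := by
    intro a' ha'
    rw [hKdef, mem_stencilBall_iff hκ.le]
    intro σ
    rw [entry_add_single]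
    split_ifs with h
    · subst h; simpa using ha'
    · exact hpE σ
  have T := ((inward _ (hin (ε • a) hεa)).sub
    (inward _ (hin 0 (by simpa using (mul_pos hκ (norm_vec_pos ρ)).le)))).const_mul ε⁻¹
  have key : ∀ q, ε⁻¹ * (derivAlong K (Stencil.single ρ (ε • a - entry p ρ)) f q -
      derivAlong K (Stencil.single ρ (0 - entry p ρ)) f q) =
      derivAlong K (Stencil.single ρ a) f q := by
    intro q
    simp only [derivAlong, map_sub, map_smul, map_zero, smul_eq_mul]
    field_simp
    ring
  simpa only [key] using T

/-- Second-order Taylor estimate on the ball in terms of partial derivatives. The derivative of `f`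
is a functional on a space of bounded families, and need not be the sum of its partial derivatives
in general; for `f` determined by finite truncations it is, since the estimate holds with constants
independent of the truncation. -/
theorem TruncContinuous.abs_sub_sub_tsum_le (hκ : 0 < κ)
    (hf : ContDiffOn ℝ 2 f (stencilBall d κ)) (ht : TruncContinuous κ f)
    (hb : ∀ p ∈ stencilBall d κ, ∀ σ τ a c,
      |derivAlong (stencilBall d κ) (Stencil.single σ a)
        (derivAlong (stencilBall d κ) (Stencil.single τ c) f) p| ≤ b σ τ * ‖a‖ * ‖c‖)
    {m : Dir d → ℝ}
    (hm : ∀ p ∈ stencilBall d κ, ∀ σ a,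
      |derivAlong (stencilBall d κ) (Stencil.single σ a) f p| ≤ m σ * ‖a‖)
    (hms : Summable fun σ => m σ * ‖σ.vec‖) {g h : Stencil d}
    (hg : g ∈ stencilBall d κ) (hh : h ∈ stencilBall d κ)
    (hbs : Summable fun q : Dir d × Dir d =>
      b q.1 q.2 * ‖entry (g - h) q.1‖ * ‖entry (g - h) q.2‖) :
    |f g - f h - ∑' σ, derivAlong (stencilBall d κ) (Stencil.single σ (entry (g - h) σ)) f h| ≤
      ∑' q : Dir d × Dir d, b q.1 q.2 * ‖entry (g - h) q.1‖ * ‖entry (g - h) q.2‖ := by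
  classical
  set K := stencilBall d κ with hKdef
  have hKc : Convex ℝ K := convex_stencilBall κ
  have hU : UniqueDiffOn ℝ K := uniqueDiffOn_stencilBall hκ
  set B := ∑' q : Dir d × Dir d, b q.1 q.2 * ‖entry (g - h) q.1‖ * ‖entry (g - h) q.2‖ with hB
  have hpos : ∀ q : Dir d × Dir d,
      0 ≤ b q.1 q.2 * ‖entry (g - h) q.1‖ * ‖entry (g - h) q.2‖ := fun q =>
    (abs_nonneg _).trans (hb g hg q.1 q.2 _ _)
  -- the estimate for the truncations to `s`, with a bound that does not depend on `s`
  have fin : ∀ s : Finset (Dir d), |f (truncate s g) - f (truncate s h) -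
      ∑ σ ∈ s, derivAlong K (Stencil.single σ (entry (g - h) σ)) f (truncate s h)| ≤ B := by
    intro s
    have := abs_sub_sub_derivAlong_le hKc hU hf (truncate_mem hκ.le s hg)
      (truncate_mem hκ.le s hh) (B := B) ?_
    · rwa [truncate_sub, derivAlong_sum_smul] at this
    · intro p hp
      rw [truncate_sub, derivAlong_sum_smul]
      have e1 : ∀ σ, derivAlong K (Stencil.single σ (entry (g - h) σ))
          (derivAlong K (∑ ρ ∈ s, Stencil.single ρ (entry (g - h) ρ)) f) p =
          ∑ τ ∈ s, derivAlong K (Stencil.single σ (entry (g - h) σ))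
            (derivAlong K (Stencil.single τ (entry (g - h) τ)) f) p := by
        intro σ
        have e2 : derivAlong K (∑ ρ ∈ s, Stencil.single ρ (entry (g - h) ρ)) f =
            fun q => ∑ τ ∈ s, derivAlong K (Stencil.single τ (entry (g - h) τ)) f q := by
          funext q
          rw [derivAlong_sum_smul]
        rw [e2]
        have hd : ∀ τ ∈ s, DifferentiableWithinAt ℝ
            (derivAlong K (Stencil.single τ (entry (g - h) τ)) f) K p := fun τ _ =>
          (derivAlong_contDiffOn hU hf (m := 1) (by norm_num) _).differentiableOn (by norm_num) p hp
        rw [derivAlong, fderivWithin_fun_sum (hU p hp) hd]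
        simp [derivAlong]
      simp_rw [e1]
      rw [← Finset.sum_product']
      refine (Finset.abs_sum_le_sum_abs _ _).trans ?_
      refine (Finset.sum_le_sum fun q _ => hb p hp q.1 q.2 _ _).trans ?_
      exact hbs.sum_le_tsum _ fun q _ => hpos q
  have hsum : Summable fun σ => m σ * ‖entry (g - h) σ‖ := by
    refine Summable.of_nonneg_of_le (fun σ => (abs_nonneg _).trans (hm g hg σ _)) (fun σ => ?_)
      (hms.mul_left ‖g - h‖)
    have h0 : 0 ≤ m σ := by
      have := (abs_nonneg _).trans (hm g hg σ σ.vec)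
      exact nonneg_of_mul_nonneg_left this (norm_vec_pos σ)
    have := mul_le_mul_of_nonneg_left (norm_entry_le (g - h) σ) h0
    linarith
  have lim : Tendsto (fun s : Finset (Dir d) =>
      ∑ σ ∈ s, derivAlong K (Stencil.single σ (entry (g - h) σ)) f (truncate s h)) atTop
      (𝓝 (∑' σ, derivAlong K (Stencil.single σ (entry (g - h) σ)) f h)) := by
    have T := tendsto_tsum_of_dominated_convergence (𝓕 := (atTop : Filter (Finset (Dir d))))
      (f := fun s σ => if σ ∈ s then
        derivAlong K (Stencil.single σ (entry (g - h) σ)) f (truncate s h) else 0)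
      (g := fun σ => derivAlong K (Stencil.single σ (entry (g - h) σ)) f h) hsum ?_ ?_
    · refine T.congr fun s => ?_
      rw [tsum_eq_sum (s := s) (fun σ hσ => by simp [hσ])]
      exact Finset.sum_congr rfl fun σ hσ => by simp [hσ]
    · intro σ
      refine (ht.derivAlong_single hκ hf hb σ _ h hh).congr' ?_
      filter_upwards [eventually_ge_atTop {σ}] with s hs
      rw [if_pos (hs (by simp))]
    · refine Eventually.of_forall fun s σ => ?_
      split_ifs
      · exact hm _ (truncate_mem hκ.le s hh) σ _
      · simpa using (abs_nonneg _).trans (hm g hg σ _)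
  exact le_of_tendsto (((ht g hg).sub (ht h hh)).sub lim).abs (Eventually.of_forall fin)

end Stencil

/-! ### The site energy and its partial derivatives -/

section SiteEnergy

open Stencil

variable {d : ℕ}

/-- The real-valued site energy. -/
noncomputable def realEnergy (V : Stencil d → EReal) : Stencil d → ℝ := fun g => (V g).toReal

/-- `sup_{g ∈ 𝒟_κ} ‖V_ρ(g)‖`, as a real number. -/
noncomputable def derivSup (V : Stencil d → EReal) (κ : ℝ) {j : ℕ} (ρ : Fin j → Dir d) : ℝ :=
  (⨆ g ∈ stencilBall d κ, ‖partialDeriv V κ ρ g‖ₑ).toReal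

variable {V : Stencil d → EReal} {κ : ℝ} {k : ℕ}

theorem partialDeriv_apply {j : ℕ} (ρ : Fin j → Dir d) (g : Stencil d) (m : Fin j → Space d) :
    partialDeriv V κ ρ g m = iteratedFDerivWithin ℝ j (realEnergy V) (stencilBall d κ) g
      (fun i => Stencil.single (ρ i) (m i)) := rfl

theorem derivSup_nonneg {j : ℕ} (ρ : Fin j → Dir d) : 0 ≤ derivSup V κ ρ := ENNReal.toReal_nonneg

theorem mBound_ne_top (hV : IsSiteEnergy V κ k) {j : ℕ} (hj : 1 ≤ j) (hjk : j ≤ k)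
    (ρ : Fin j → Dir d) : mBound V κ ρ ≠ ∞ :=
  ((ENNReal.le_tsum ρ).trans_lt (hV.decay j hj hjk)).ne

theorem prod_enorm_vec_ne_zero {j : ℕ} (ρ : Fin j → Dir d) : ∏ i, ‖(ρ i).vec‖ₑ ≠ 0 :=
  Finset.prod_ne_zero_iff.2 fun i _ => by simpa using (ρ i).vec_ne_zero

theorem iSup_partialDeriv_ne_top (hV : IsSiteEnergy V κ k) {j : ℕ} (hj : 1 ≤ j) (hjk : j ≤ k)
    (ρ : Fin j → Dir d) : (⨆ g ∈ stencilBall d κ, ‖partialDeriv V κ ρ g‖ₑ) ≠ ∞ := by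
  intro h
  apply mBound_ne_top hV hj hjk ρ
  rw [mBound, h, ENNReal.mul_top (prod_enorm_vec_ne_zero ρ)]

theorem mBound_eq (hV : IsSiteEnergy V κ k) {j : ℕ} (hj : 1 ≤ j) (hjk : j ≤ k)
    (ρ : Fin j → Dir d) :
    mBound V κ ρ = ENNReal.ofReal (derivSup V κ ρ * ∏ i, ‖(ρ i).vec‖) := by
  rw [mul_comm, ENNReal.ofReal_mul (Finset.prod_nonneg fun i _ => norm_nonneg _),
    ENNReal.ofReal_prod_of_nonneg (fun i _ => norm_nonneg _), derivSup,
    ENNReal.ofReal_toReal (iSup_partialDeriv_ne_top hV hj hjk ρ), mBound]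
  simp only [ofReal_norm]

theorem summable_derivSup (hV : IsSiteEnergy V κ k) {j : ℕ} (hj : 1 ≤ j) (hjk : j ≤ k) :
    Summable fun ρ : Fin j → Dir d => derivSup V κ ρ * ∏ i, ‖(ρ i).vec‖ := by
  have h := ENNReal.summable_toReal (hV.decay j hj hjk).ne
  refine h.congr fun ρ => ?_
  rw [mBound_eq hV hj hjk, ENNReal.toReal_ofReal]
  exact mul_nonneg (derivSup_nonneg ρ) (Finset.prod_nonneg fun i _ => norm_nonneg _)

theorem abs_partialDeriv_le (hV : IsSiteEnergy V κ k) {j : ℕ} (hj : 1 ≤ j) (hjk : j ≤ k)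
    (ρ : Fin j → Dir d) {g : Stencil d} (hg : g ∈ stencilBall d κ) (m : Fin j → Space d) :
    |partialDeriv V κ ρ g m| ≤ derivSup V κ ρ * ∏ i, ‖m i‖ := by
  refine ((partialDeriv V κ ρ g).le_opNorm m).trans ?_
  refine mul_le_mul_of_nonneg_right ?_ (Finset.prod_nonneg fun i _ => norm_nonneg _)
  rw [← toReal_enorm]
  exact ENNReal.toReal_mono (iSup_partialDeriv_ne_top hV hj hjk ρ)
    (le_iSup₂ (f := fun g (_ : g ∈ stencilBall d κ) => ‖partialDeriv V κ ρ g‖ₑ) g hg)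

theorem partialDeriv_one (hκ : 0 < κ) (ρ : Fin 1 → Dir d) {g : Stencil d}
    (hg : g ∈ stencilBall d κ) (m : Fin 1 → Space d) :
    partialDeriv V κ ρ g m =
      derivAlong (stencilBall d κ) (Stencil.single (ρ 0) (m 0)) (realEnergy V) g :=
  (partialDeriv_apply ρ g m).trans
    (iteratedFDerivWithin_one_eq_derivAlong (uniqueDiffOn_stencilBall hκ) hg _)

theorem realEnergy_contDiffOn (hV : IsSiteEnergy V κ k) {n : ℕ} (hn : n ≤ k) :
    ContDiffOn ℝ (n : WithTop ℕ∞) (realEnergy V) (stencilBall d κ) :=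
  hV.smooth.of_le (by exact_mod_cast hn)

theorem partialDeriv_two (hκ : 0 < κ) (hV : IsSiteEnergy V κ k) (hk : 2 ≤ k) (ρ : Fin 2 → Dir d) {g : Stencil d}
    (hg : g ∈ stencilBall d κ) (m : Fin 2 → Space d) :
    partialDeriv V κ ρ g m =
      derivAlong (stencilBall d κ) (Stencil.single (ρ 0) (m 0))
        (derivAlong (stencilBall d κ) (Stencil.single (ρ 1) (m 1)) (realEnergy V)) g := by
  have hU := uniqueDiffOn_stencilBall (d := d) hκ
  rw [partialDeriv_apply, iteratedFDerivWithin_succ_eq_derivAlong hU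
    (by exact_mod_cast realEnergy_contDiffOn hV (n := 2) hk) hg]
  refine derivAlong_congr (fun q hq => ?_) hg _
  rw [iteratedFDerivWithin_one_eq_derivAlong hU hq]
  rfl

theorem partialDeriv_three (hκ : 0 < κ) (hV : IsSiteEnergy V κ k) (hk : 3 ≤ k) (ρ : Fin 3 → Dir d) {g : Stencil d}
    (hg : g ∈ stencilBall d κ) (m : Fin 3 → Space d) :
    partialDeriv V κ ρ g m =
      derivAlong (stencilBall d κ) (Stencil.single (ρ 0) (m 0))
        (derivAlong (stencilBall d κ) (Stencil.single (ρ 1) (m 1))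
          (derivAlong (stencilBall d κ) (Stencil.single (ρ 2) (m 2)) (realEnergy V))) g := by
  have hU := uniqueDiffOn_stencilBall (d := d) hκ
  rw [partialDeriv_apply, iteratedFDerivWithin_succ_eq_derivAlong hU
    (by exact_mod_cast realEnergy_contDiffOn hV (n := 3) hk) hg]
  refine derivAlong_congr (fun q hq => ?_) hg _
  exact partialDeriv_two hκ hV (by omega) (Fin.tail ρ) hq (Fin.tail m)

theorem realEnergy_truncContinuous (hV : IsSiteEnergy V κ k) : TruncContinuous κ (realEnergy V) := fun g hg =>
  (EReal.tendsto_toReal (hV.finite g hg).2 (hV.finite g hg).1).comp (hV.truncation g hg)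

theorem abs_derivAlong_realEnergy_le (hκ : 0 < κ) (hV : IsSiteEnergy V κ k) (hk : 3 ≤ k) {p : Stencil d} (hp : p ∈ stencilBall d κ)
    (σ : Dir d) (a : Space d) :
    |derivAlong (stencilBall d κ) (Stencil.single σ a) (realEnergy V) p| ≤
      derivSup V κ ![σ] * ‖a‖ := by
  have := abs_partialDeriv_le hV le_rfl (by omega) ![σ] hp ![a]
  rw [partialDeriv_one hκ _ hp] at this
  simpa using this

theorem abs_derivAlong_two_le (hκ : 0 < κ) (hV : IsSiteEnergy V κ k) (hk : 3 ≤ k) {p : Stencil d} (hp : p ∈ stencilBall d κ)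
    (σ τ : Dir d) (a c : Space d) :
    |derivAlong (stencilBall d κ) (Stencil.single σ a)
      (derivAlong (stencilBall d κ) (Stencil.single τ c) (realEnergy V)) p| ≤
      derivSup V κ ![σ, τ] * ‖a‖ * ‖c‖ := by
  have := abs_partialDeriv_le hV (by norm_num) (by omega) ![σ, τ] hp ![a, c]
  rw [partialDeriv_two hκ hV (by omega) _ hp] at this
  simpa [Fin.prod_univ_two, mul_assoc] using this

theorem derivAlong_realEnergy_contDiffOn (hκ : 0 < κ) (hV : IsSiteEnergy V κ k) (hk : 3 ≤ k) (v : Stencil d) :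
    ContDiffOn ℝ 2 (derivAlong (stencilBall d κ) v (realEnergy V)) (stencilBall d κ) :=
  derivAlong_contDiffOn (uniqueDiffOn_stencilBall hκ)
    (realEnergy_contDiffOn hV (n := 3) hk) (by norm_num) v

/-- The third derivative is invariant under a cyclic permutation of its arguments, by two uses of
the symmetry of second derivatives. -/
theorem derivAlong_three_comm (hκ : 0 < κ) (hV : IsSiteEnergy V κ k) (hk : 3 ≤ k) {p : Stencil d} (hp : p ∈ stencilBall d κ)
    (v w z : Stencil d) :
    derivAlong (stencilBall d κ) v (derivAlong (stencilBall d κ) w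
      (derivAlong (stencilBall d κ) z (realEnergy V))) p =
    derivAlong (stencilBall d κ) z (derivAlong (stencilBall d κ) v
      (derivAlong (stencilBall d κ) w (realEnergy V))) p := by
  have hKc := convex_stencilBall (d := d) κ
  have hKi := stencilBall_interior_nonempty (d := d) hκ
  rw [derivAlong_congr (fun q hq => derivAlong_comm hKc hKi
    (realEnergy_contDiffOn hV (n := 2) (by omega)) hq w z) hp]
  exact derivAlong_comm hKc hKi (derivAlong_realEnergy_contDiffOn hκ hV hk w) hp v z

theorem abs_derivAlong_three_le (hκ : 0 < κ) (hV : IsSiteEnergy V κ k) (hk : 3 ≤ k) {p : Stencil d} (hp : p ∈ stencilBall d κ)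
    (ρ σ τ : Dir d) (e a c : Space d) (he : ‖e‖ ≤ 1) :
    |derivAlong (stencilBall d κ) (Stencil.single σ a)
      (derivAlong (stencilBall d κ) (Stencil.single τ c)
        (derivAlong (stencilBall d κ) (Stencil.single ρ e) (realEnergy V))) p| ≤
      derivSup V κ ![ρ, σ, τ] * ‖a‖ * ‖c‖ := by
  rw [derivAlong_three_comm hκ hV hk hp]
  have := abs_partialDeriv_le hV (by norm_num) (by omega) ![ρ, σ, τ] hp ![e, a, c]
  rw [partialDeriv_three hκ hV hk _ hp] at this
  refine (by simpa [Fin.prod_univ_three] using this : _ ≤ _).trans ?_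
  have h0 := derivSup_nonneg (V := V) (κ := κ) ![ρ, σ, τ]
  have h1 : ‖e‖ * (‖a‖ * ‖c‖) ≤ 1 * (‖a‖ * ‖c‖) := by gcongr
  calc _ = derivSup V κ ![ρ, σ, τ] * (‖e‖ * (‖a‖ * ‖c‖)) := by ring
    _ ≤ _ := mul_le_mul_of_nonneg_left h1 h0
    _ = _ := by ring

theorem summable_derivSup_one (hV : IsSiteEnergy V κ k) (hk : 3 ≤ k) :
    Summable fun ρ : Dir d => derivSup V κ ![ρ] * ‖ρ.vec‖ := by
  have := summable_derivSup hV (j := 1) le_rfl (by omega)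
  refine (this.comp_injective (i := fun ρ : Dir d => ![ρ])
    fun a b h => congrFun h 0).congr fun ρ => ?_
  simp

theorem summable_derivSup_two (hV : IsSiteEnergy V κ k) (hk : 3 ≤ k) :
    Summable fun q : Dir d × Dir d =>
      derivSup V κ ![q.1, q.2] * ‖q.1.vec‖ * ‖q.2.vec‖ := by
  have := summable_derivSup hV (j := 2) (by norm_num) (by omega)
  rw [← (finTwoArrowEquiv (Dir d)).symm.summable_iff] at this
  refine this.congr fun q => ?_
  simp [Fin.prod_univ_two, mul_assoc]

theorem summable_derivSup_three (hV : IsSiteEnergy V κ k) (hk : 3 ≤ k) :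
    Summable fun q : Dir d × Dir d × Dir d =>
      derivSup V κ ![q.1, q.2.1, q.2.2] * ‖q.1.vec‖ * ‖q.2.1.vec‖ * ‖q.2.2.vec‖ := by
  have := summable_derivSup hV (j := 3) (by norm_num) (by omega)
  have hinj : Function.Injective fun q : Dir d × Dir d × Dir d => ![q.1, q.2.1, q.2.2] := by
    rintro ⟨a, b, c⟩ ⟨a', b', c'⟩ h
    have h0 := congrFun h 0
    have h1 := congrFun h 1
    have h2 := congrFun h 2
    simp at h0 h1 h2
    simp [h0, h1, h2]
  refine (this.comp_injective hinj).congr fun q => ?_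
  simp [Fin.prod_univ_three, mul_assoc]

/-- First-order Taylor expansion of the energy. -/
theorem abs_realEnergy_sub_le (hκ : 0 < κ) (hV : IsSiteEnergy V κ k) (hk : 3 ≤ k) {g h : Stencil d}
    (hg : g ∈ stencilBall d κ) (hh : h ∈ stencilBall d κ) :
    |realEnergy V g - realEnergy V h -
      ∑' σ, derivAlong (stencilBall d κ) (Stencil.single σ (entry (g - h) σ)) (realEnergy V) h| ≤
      (∑' q : Dir d × Dir d, derivSup V κ ![q.1, q.2] * ‖q.1.vec‖ * ‖q.2.vec‖) *
        ‖g - h‖ ^ 2 := by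
  have hle : ∀ q : Dir d × Dir d,
      derivSup V κ ![q.1, q.2] * ‖entry (g - h) q.1‖ * ‖entry (g - h) q.2‖ ≤
      derivSup V κ ![q.1, q.2] * ‖q.1.vec‖ * ‖q.2.vec‖ * ‖g - h‖ ^ 2 := by
    intro q
    have h0 := derivSup_nonneg (V := V) (κ := κ) ![q.1, q.2]
    calc _ ≤ derivSup V κ ![q.1, q.2] * (‖g - h‖ * ‖q.1.vec‖) * (‖g - h‖ * ‖q.2.vec‖) := by
          gcongr <;> exact norm_entry_le _ _
      _ = _ := by ring
  have hS := (summable_derivSup_two hV hk).mul_right (‖g - h‖ ^ 2)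
  have hS' : Summable fun q : Dir d × Dir d =>
      derivSup V κ ![q.1, q.2] * ‖entry (g - h) q.1‖ * ‖entry (g - h) q.2‖ :=
    Summable.of_nonneg_of_le (fun q => mul_nonneg (mul_nonneg (derivSup_nonneg _)
      (norm_nonneg _)) (norm_nonneg _)) hle hS
  refine ((realEnergy_truncContinuous hV).abs_sub_sub_tsum_le hκ
    (b := fun σ τ => derivSup V κ ![σ, τ]) (m := fun σ => derivSup V κ ![σ])
    (realEnergy_contDiffOn hV (n := 2) (by omega))
    (fun p hp σ τ a c => abs_derivAlong_two_le hκ hV hk hp σ τ a c)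
    (fun p hp σ a => abs_derivAlong_realEnergy_le hκ hV hk hp σ a)
    (summable_derivSup_one hV hk) hg hh hS').trans ?_
  rw [← tsum_mul_right]
  exact hS'.tsum_le_tsum hle hS

/-- First-order Taylor expansion of the partial derivatives `V_ρ` of the energy. -/
theorem abs_partialDeriv_sub_le (hκ : 0 < κ) (hV : IsSiteEnergy V κ k) (hk : 3 ≤ k) (ρ : Dir d) {e : Space d} (he : ‖e‖ ≤ 1)
    {g h : Stencil d} (hg : g ∈ stencilBall d κ) (hh : h ∈ stencilBall d κ) :
    |partialDeriv V κ ![ρ] g ![e] - partialDeriv V κ ![ρ] h ![e] -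
      ∑' σ, partialDeriv V κ ![ρ, σ] h ![e, entry (g - h) σ]| ≤
      ∑' q : Dir d × Dir d,
        derivSup V κ ![ρ, q.1, q.2] * ‖entry (g - h) q.1‖ * ‖entry (g - h) q.2‖ := by
  have hKc := convex_stencilBall (d := d) κ
  have hKi := stencilBall_interior_nonempty (d := d) hκ
  have comm : ∀ p ∈ stencilBall d κ, ∀ σ a,
      derivAlong (stencilBall d κ) (Stencil.single σ a)
        (derivAlong (stencilBall d κ) (Stencil.single ρ e) (realEnergy V)) p =
      partialDeriv V κ ![ρ, σ] p ![e, a] := by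
    intro p hp σ a
    rw [partialDeriv_two hκ hV (by omega) _ hp]
    exact derivAlong_comm hKc hKi (realEnergy_contDiffOn hV (n := 2) (by omega)) hp _ _
  have hρ := norm_vec_pos ρ
  have hS3 : Summable fun q : Dir d × Dir d =>
      derivSup V κ ![ρ, q.1, q.2] * ‖q.1.vec‖ * ‖q.2.vec‖ := by
    have h := (summable_derivSup_three hV hk).comp_injective
      (i := fun q : Dir d × Dir d => (ρ, q)) (Prod.mk_right_injective ρ)
    refine (h.mul_left ‖ρ.vec‖⁻¹).congr fun q => ?_
    simp only [Function.comp]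
    field_simp
  have hS2 : Summable fun σ : Dir d => derivSup V κ ![ρ, σ] * ‖σ.vec‖ := by
    have h := (summable_derivSup_two hV hk).comp_injective
      (i := fun σ : Dir d => (ρ, σ)) (Prod.mk_right_injective ρ)
    refine (h.mul_left ‖ρ.vec‖⁻¹).congr fun q => ?_
    simp only [Function.comp]
    field_simp
  have hle : ∀ q : Dir d × Dir d,
      derivSup V κ ![ρ, q.1, q.2] * ‖entry (g - h) q.1‖ * ‖entry (g - h) q.2‖ ≤
      derivSup V κ ![ρ, q.1, q.2] * ‖q.1.vec‖ * ‖q.2.vec‖ * ‖g - h‖ ^ 2 := by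
    intro q
    have h0 := derivSup_nonneg (V := V) (κ := κ) ![ρ, q.1, q.2]
    calc _ ≤ derivSup V κ ![ρ, q.1, q.2] * (‖g - h‖ * ‖q.1.vec‖) * (‖g - h‖ * ‖q.2.vec‖) := by
          gcongr <;> exact norm_entry_le _ _
      _ = _ := by ring
  have hS' : Summable fun q : Dir d × Dir d =>
      derivSup V κ ![ρ, q.1, q.2] * ‖entry (g - h) q.1‖ * ‖entry (g - h) q.2‖ :=
    Summable.of_nonneg_of_le (fun q => mul_nonneg (mul_nonneg (derivSup_nonneg _)
      (norm_nonneg _)) (norm_nonneg _)) hle (hS3.mul_right _)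
  have ht := (realEnergy_truncContinuous hV).derivAlong_single hκ
    (realEnergy_contDiffOn hV (n := 2) (by omega))
    (fun p hp σ τ a c => abs_derivAlong_two_le hκ hV hk hp σ τ a c) ρ e
  have := ht.abs_sub_sub_tsum_le hκ
    (b := fun σ τ => derivSup V κ ![ρ, σ, τ]) (m := fun σ => derivSup V κ ![ρ, σ])
    (derivAlong_realEnergy_contDiffOn hκ hV hk _)
    (fun p hp σ τ a c => abs_derivAlong_three_le hκ hV hk hp ρ σ τ e a c he) ?_ hS2 hg hh hS'
  · rw [tsum_congr (fun σ => comm h hh σ _)] at this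
    rw [partialDeriv_one hκ _ hg, partialDeriv_one hκ _ hh]
    exact this
  · intro p hp σ a
    rw [comm p hp]
    refine (abs_partialDeriv_le hV (by norm_num) (by omega) ![ρ, σ] hp ![e, a]).trans ?_
    have h0 := derivSup_nonneg (V := V) (κ := κ) ![ρ, σ]
    simp only [Fin.prod_univ_two, Matrix.cons_val_zero, Matrix.cons_val_one]
    have h1 : ‖e‖ * ‖a‖ ≤ 1 * ‖a‖ := by gcongr
    simpa using mul_le_mul_of_nonneg_left h1 h0

/-! ### Inversion symmetry -/

/-- The reflection `g ↦ (-g_{-ρ})_ρ`. -/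
noncomputable def reflect (d : ℕ) : Stencil d →L[ℝ] Stencil d :=
  LinearMap.mkContinuous
    { toFun := fun g => ⟨fun ρ => -g (Dir.opp ρ), memℓp_infty ⟨‖g‖, by
        rintro _ ⟨ρ, rfl⟩
        simpa using lp.norm_apply_le_norm ENNReal.top_ne_zero g (Dir.opp ρ)⟩⟩
      map_add' := fun g h => by
        apply lp.ext
        funext ρ
        change -((g + h : Stencil d) (Dir.opp ρ)) = -g (Dir.opp ρ) + -h (Dir.opp ρ)
        simp [add_comm]
      map_smul' := fun c g => by
        apply lp.ext
        funext ρ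
        change -((c • g : Stencil d) (Dir.opp ρ)) = c • -g (Dir.opp ρ)
        simp } 1 fun g => by
    rw [one_mul]
    refine lp.norm_le_of_forall_le (norm_nonneg g) fun ρ => ?_
    change ‖-g (Dir.opp ρ)‖ ≤ ‖g‖
    simpa using lp.norm_apply_le_norm ENNReal.top_ne_zero g (Dir.opp ρ)

theorem vec_opp (ρ : Dir d) : (Dir.opp ρ).vec = -ρ.vec := by
  ext i
  simp [Dir.opp, Dir.vec, Site.pt]

theorem opp_opp (ρ : Dir d) : Dir.opp (Dir.opp ρ) = ρ := by
  apply Subtype.ext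
  simp [Dir.opp]

theorem entry_reflect (g : Stencil d) (ρ : Dir d) :
    entry (reflect d g) ρ = -entry g (Dir.opp ρ) := by
  change ‖ρ.vec‖ • -g (Dir.opp ρ) = _
  rw [entry, vec_opp, norm_neg, smul_neg]

theorem reflect_single (ρ : Dir d) (a : Space d) :
    reflect d (Stencil.single ρ a) = -Stencil.single (Dir.opp ρ) a := by
  refine ext_entry fun σ => ?_
  have h : (Dir.opp σ = ρ) ↔ (σ = Dir.opp ρ) :=
    ⟨fun h => by rw [← h, opp_opp], fun h => by rw [h, opp_opp]⟩
  rw [entry_reflect, entry_single, ← map_neg, entry_single]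
  simp only [h]
  split_ifs <;> simp

theorem entry_homStencil (F : Space d →L[ℝ] Space d) (ρ : Dir d) :
    entry (homStencil F) ρ = F ρ.vec :=
  entry_ofFun _ ‖F‖ (fun _ => F.le_opNorm _) ρ

theorem homStencil_mem {F : Space d →L[ℝ] Space d} (hF : F ∈ gradBall d κ) (hκ : 0 < κ) :
    homStencil F ∈ stencilBall d κ := by
  rw [mem_stencilBall_iff hκ.le]
  intro ρ
  rw [entry_homStencil]
  exact F.le_of_opNorm_le (by simpa [gradBall] using hF) _

theorem reflect_homStencil (F : Space d →L[ℝ] Space d) :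
    reflect d (homStencil F) = homStencil F := by
  refine ext_entry fun ρ => ?_
  rw [entry_reflect, entry_homStencil, entry_homStencil, vec_opp]
  simp

theorem derivAlong_neg {E : Type*} [NormedAddCommGroup E] [NormedSpace ℝ E] (K : Set E) (v : E)
    (f : E → ℝ) : derivAlong K (-v) f = fun p => -derivAlong K v f p := by
  funext p
  simp [derivAlong]

theorem reflect_mem {p : Stencil d} (hκ : 0 < κ) (hp : p ∈ stencilBall d κ) :
    reflect d p ∈ stencilBall d κ := by
  rw [mem_stencilBall_iff hκ.le] at hp ⊢
  intro ρ
  rw [entry_reflect, norm_neg]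
  have := hp (Dir.opp ρ)
  rwa [vec_opp, norm_neg] at this

theorem derivAlong_comp_reflect (hκ : 0 < κ) {f : Stencil d → ℝ}
    (hf : DifferentiableOn ℝ f (stencilBall d κ)) (v : Stencil d) {p : Stencil d}
    (hp : p ∈ stencilBall d κ) :
    derivAlong (stencilBall d κ) v (fun q => f (reflect d q)) p =
      derivAlong (stencilBall d κ) (reflect d v) f (reflect d p) := by
  have hd := (hf _ (reflect_mem hκ hp)).hasFDerivWithinAt
  have h := (hd.comp p (reflect d).hasFDerivAt.hasFDerivWithinAt
    (fun q hq => reflect_mem hκ hq)).fderivWithin (uniqueDiffOn_stencilBall hκ p hp)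
  unfold derivAlong
  have e : (fun q => f (reflect d q)) = f ∘ reflect d := rfl
  rw [e, h]
  rfl

/-- Inversion symmetry of the second derivatives at homogeneous stencils. -/
theorem partialDeriv_two_opp (hκ : 0 < κ) (hV : IsSiteEnergy V κ k) (hk : 3 ≤ k) {F : Space d →L[ℝ] Space d} (hF : F ∈ gradBall d κ)
    (ρ σ : Dir d) (a c : Space d) :
    partialDeriv V κ ![Dir.opp ρ, Dir.opp σ] (homStencil F) ![a, c] =
      partialDeriv V κ ![ρ, σ] (homStencil F) ![a, c] := by
  have hmem := homStencil_mem hF hκ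
  have hU := uniqueDiffOn_stencilBall (d := d) hκ
  have h2 := realEnergy_contDiffOn hV (n := 2) (by omega)
  have hsymm : (fun q => realEnergy V (reflect d q)) = realEnergy V := by
    funext q
    simp only [realEnergy]
    rw [hV.symm q (reflect d q) (entry_reflect q)]
  have hone : ∀ w, ∀ p ∈ stencilBall d κ, derivAlong (stencilBall d κ) w (realEnergy V) p =
      derivAlong (stencilBall d κ) (reflect d w) (realEnergy V) (reflect d p) := by
    intro w p hp
    conv_lhs => rw [← hsymm]
    exact derivAlong_comp_reflect hκ (h2.differentiableOn (by norm_num)) w hp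
  rw [partialDeriv_two hκ hV (by omega) _ hmem, partialDeriv_two hκ hV (by omega) _ hmem]
  simp only [Matrix.cons_val_zero, Matrix.cons_val_one]
  symm
  rw [derivAlong_congr (hone _) hmem, derivAlong_comp_reflect hκ
    ((derivAlong_contDiffOn hU h2 (m := 1) (by norm_num) _).differentiableOn (by norm_num)) _ hmem,
    reflect_homStencil, reflect_single, reflect_single, derivAlong_neg, derivAlong_neg]
  have e : (fun p => -derivAlong (stencilBall d κ) (Stencil.single (Dir.opp σ) c)
      (realEnergy V) p) =
      -derivAlong (stencilBall d κ) (Stencil.single (Dir.opp σ) c) (realEnergy V) := rfl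
  simp only [e]
  unfold derivAlong
  rw [fderivWithin_neg (hU _ hmem)]
  simp

/-! ### The Cauchy–Born energy density -/

/-- The stored energy density is differentiable on the ball of admissible gradients, and its
derivative is the sum of the partial derivatives of the site energy. -/
theorem hasFDerivWithinAt_cbEnergy (hκ : 0 < κ) (hV : IsSiteEnergy V κ k) (hk : 3 ≤ k) {F : Space d →L[ℝ] Space d}
    (hF : F ∈ gradBall d κ) :
    ∃ L : (Space d →L[ℝ] Space d) →L[ℝ] ℝ,
      HasFDerivWithinAt (fun F => (cbEnergy V F).toReal) L (gradBall d κ) F ∧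
      ∀ G : Space d →L[ℝ] Space d,
        L G = ∑' ρ : Dir d, partialDeriv V κ ![ρ] (homStencil F) ![G ρ.vec] := by
  have hmem := homStencil_mem hF hκ
  have hsum : ∀ G : Space d →L[ℝ] Space d, Summable fun ρ : Dir d =>
      derivAlong (stencilBall d κ) (Stencil.single ρ (G ρ.vec)) (realEnergy V) (homStencil F) := by
    intro G
    refine Summable.of_norm_bounded ((summable_derivSup_one hV hk).mul_right ‖G‖) fun ρ => ?_
    refine (abs_derivAlong_realEnergy_le hκ hV hk hmem ρ _).trans ?_
    rw [mul_assoc]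
    refine mul_le_mul_of_nonneg_left ?_ (derivSup_nonneg _)
    rw [mul_comm]
    exact G.le_opNorm _
  let L₀ : (Space d →L[ℝ] Space d) →ₗ[ℝ] ℝ :=
    { toFun := fun G => ∑' ρ : Dir d,
        derivAlong (stencilBall d κ) (Stencil.single ρ (G ρ.vec)) (realEnergy V) (homStencil F)
      map_add' := fun G H => by
        rw [← (hsum G).tsum_add (hsum H)]
        exact tsum_congr fun ρ => by simp [derivAlong]
      map_smul' := fun c G => by
        rw [RingHom.id_apply, smul_eq_mul, ← tsum_mul_left]
        exact tsum_congr fun ρ => by simp [derivAlong] }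
  refine ⟨LinearMap.toContinuousLinearMap L₀, ?_, fun G => ?_⟩
  · set M := ∑' q : Dir d × Dir d, derivSup V κ ![q.1, q.2] * ‖q.1.vec‖ * ‖q.2.vec‖ with hM
    have hM0 : 0 ≤ M := tsum_nonneg fun q => mul_nonneg (mul_nonneg (derivSup_nonneg _)
      (norm_nonneg _)) (norm_nonneg _)
    have hent : ∀ F' : Space d →L[ℝ] Space d, ∀ ρ,
        entry (homStencil F' - homStencil F) ρ = (F' - F) ρ.vec := fun F' ρ => by
      rw [entry_sub, entry_homStencil, entry_homStencil]; rfl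
    have est : ∀ F' ∈ gradBall d κ,
        ‖(cbEnergy V F').toReal - (cbEnergy V F).toReal - L₀ (F' - F)‖ ≤ M * ‖F' - F‖ ^ 2 := by
      intro F' hF'
      have h := abs_realEnergy_sub_le hκ hV hk (homStencil_mem hF' hκ) hmem
      simp_rw [hent] at h
      refine h.trans (mul_le_mul_of_nonneg_left ?_ hM0)
      have : ‖homStencil F' - homStencil F‖ ≤ ‖F' - F‖ := by
        have h' := (mem_stencilBall_iff (d := d) (norm_nonneg (F' - F))
          (g := homStencil F' - homStencil F)).2 fun ρ => by
            rw [hent]; exact (F' - F).le_opNorm _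
        simpa [stencilBall] using h'
      gcongr
    rw [hasFDerivWithinAt_iff_isLittleO]
    have hO : (fun F' => (cbEnergy V F').toReal - (cbEnergy V F).toReal -
        LinearMap.toContinuousLinearMap L₀ (F' - F)) =O[𝓝[gradBall d κ] F]
        fun F' => ‖F' - F‖ ^ 2 := by
      refine Asymptotics.IsBigO.of_bound M ?_
      filter_upwards [self_mem_nhdsWithin] with F' hF'
      simpa using est F' hF'
    refine hO.trans_isLittleO ?_
    have h1 : (fun F' : Space d →L[ℝ] Space d => ‖F' - F‖ ^ 2) =o[𝓝 F] fun F' => F' - F := by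
      have := (Asymptotics.isLittleO_norm_pow_id (E' := Space d →L[ℝ] Space d)
        one_lt_two).comp_tendsto (tendsto_sub_nhds_zero_iff.2 (tendsto_id (α := Space d →L[ℝ] Space d) (x := 𝓝 F)))
      exact this
    exact h1.mono nhdsWithin_le_nhds
  · change (∑' ρ : Dir d, _) = _
    exact tsum_congr fun ρ => by rw [partialDeriv_one hκ _ hmem]; rfl

end SiteEnergy

/-! ### Weak gradients and mollification -/

section Sobolev

open scoped Convolution

variable {d : ℕ} {F : Type*} [NormedAddCommGroup F] [NormedSpace ℝ F]
  {f : Space d → F} {G : Space d → Space d →L[ℝ] F}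

theorem HasWeakGrad.congr (h : HasWeakGrad f G) {f' : Space d → F}
    {G' : Space d → Space d →L[ℝ] F} (hf : f =ᵐ[volume] f') (hG : G =ᵐ[volume] G') :
    HasWeakGrad f' G' where
  locInt := h.locInt.congr hf
  locInt_grad := h.locInt_grad.congr hG
  integral_eq φ hφ hc v := by
    have e1 : ∫ x, (fderiv ℝ φ x v) • f' x = ∫ x, (fderiv ℝ φ x v) • f x :=
      integral_congr_ae (hf.mono fun x hx => by simp only [hx])
    have e2 : ∫ x, φ x • (G' x v) = ∫ x, φ x • (G x v) :=
      integral_congr_ae (hG.mono fun x hx => by simp only [hx])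
    rw [e1, e2, h.integral_eq φ hφ hc v]

/-- The mollification of `f` by a bump function. -/
noncomputable def mollify (φ : ContDiffBump (0 : Space d)) (f : Space d → F) : Space d → F :=
  (φ.normed volume) ⋆[ContinuousLinearMap.lsmul ℝ ℝ, volume] f

theorem mollify_apply (φ : ContDiffBump (0 : Space d)) (f : Space d → F) (x : Space d) :
    mollify φ f x = ∫ y, φ.normed volume (x - y) • f y := by
  rw [mollify, convolution_eq_swap]
  rfl

theorem mollify_congr (φ : ContDiffBump (0 : Space d)) {f f' : Space d → F}
    (h : f =ᵐ[volume] f') (x : Space d) : mollify φ f x = mollify φ f' x := by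
  rw [mollify_apply, mollify_apply]
  exact integral_congr_ae (h.mono fun y hy => by simp only [hy])

theorem integrable_normed_sub_smul (φ : ContDiffBump (0 : Space d)) {f : Space d → F}
    (hf : LocallyIntegrable f volume) (x : Space d) :
    Integrable (fun y => φ.normed volume (x - y) • f y) volume := by
  refine hf.integrable_smul_left_of_hasCompactSupport
    (φ.continuous_normed.comp (continuous_const.sub continuous_id)) ?_
  exact φ.hasCompactSupport_normed.comp_homeomorph (Homeomorph.subLeft x)

/-- The derivative of a mollification is the mollification of the weak gradient. -/
theorem HasWeakGrad.hasFDerivAt_mollify [CompleteSpace F] (h : HasWeakGrad f G)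
    (φ : ContDiffBump (0 : Space d)) (x : Space d) :
    HasFDerivAt (mollify φ f) (mollify φ G x) x := by
  have hc := φ.hasCompactSupport_normed (μ := (volume : Measure (Space d)))
  have hs : ContDiff ℝ ((⊤ : ℕ∞) : WithTop ℕ∞) (φ.normed (volume : Measure (Space d))) :=
    φ.contDiff_normed
  have H := hc.hasFDerivAt_convolution_left (ContinuousLinearMap.lsmul ℝ ℝ)
    (hs.of_le (by exact_mod_cast le_top)) h.locInt x
  refine H.congr_fderiv ?_
  ext1 v
  have hψ : ContDiff ℝ ((⊤ : ℕ∞) : WithTop ℕ∞) fun y => φ.normed volume (x - y) :=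
    hs.comp (contDiff_const.sub contDiff_id)
  have hψc : HasCompactSupport fun y => φ.normed volume (x - y) :=
    hc.comp_homeomorph (Homeomorph.subLeft x)
  have hder : ∀ y, fderiv ℝ (fun y => φ.normed volume (x - y)) y v =
      -fderiv ℝ (φ.normed volume) (x - y) v := by
    intro y
    have hd : HasFDerivAt (φ.normed volume) (fderiv ℝ (φ.normed volume) (x - y)) (x - y) :=
      (hs.differentiable (by simp) _).hasFDerivAt
    have hl : HasFDerivAt (fun y : Space d => x - y) (-ContinuousLinearMap.id ℝ (Space d)) y :=
      (hasFDerivAt_id y).const_sub x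
    have hdl : HasFDerivAt (fun y => φ.normed volume (x - y))
        ((fderiv ℝ (φ.normed volume) (x - y)).comp (-ContinuousLinearMap.id ℝ (Space d))) y :=
      hd.comp y hl
    rw [hdl.fderiv]
    simp
  have W := h.integral_eq _ hψ hψc v
  simp only [hder, neg_smul] at W
  rw [integral_neg, neg_inj] at W
  have hint : Integrable (fun y => (fderiv ℝ (φ.normed volume) (x - y)).smulRight (f y))
      (volume : Measure (Space d)) := by
    have := (hc.fderiv (𝕜 := ℝ)).convolutionExists_left
      (ContinuousLinearMap.precompL (Space d) (ContinuousLinearMap.lsmul ℝ ℝ : ℝ →L[ℝ] F →L[ℝ] F))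
      (hs.continuous_fderiv (by simp)) h.locInt x
    have := this.integrable_swap
    refine this.congr (Eventually.of_forall fun y => ?_)
    ext w
    rfl
  have e1 : ((fderiv ℝ (φ.normed volume)) ⋆[ContinuousLinearMap.precompL (Space d)
      (ContinuousLinearMap.lsmul ℝ ℝ : ℝ →L[ℝ] F →L[ℝ] F), volume] f) x =
      ∫ y, (fderiv ℝ (φ.normed volume) (x - y)).smulRight (f y) := by
    rw [convolution_eq_swap]
    refine integral_congr_ae (Eventually.of_forall fun y => ?_)
    ext w
    rfl
  rw [e1, ContinuousLinearMap.integral_apply hint, mollify_apply,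
    ContinuousLinearMap.integral_apply (integrable_normed_sub_smul φ h.locInt_grad x)]
  simpa using W

/-- A mollification is bounded by a bound that holds almost everywhere near the point. -/
theorem norm_mollify_le (φ : ContDiffBump (0 : Space d)) {g : Space d → F} {M : ℝ} {x : Space d}
    (h : ∀ᵐ y, y ∈ Metric.ball x φ.rOut → ‖g y‖ ≤ M) : ‖mollify φ g x‖ ≤ M := by
  rw [mollify_apply]
  have hint : Integrable (fun y => φ.normed volume (x - y) * M) (volume : Measure (Space d)) :=
    (φ.integrable_normed.comp_sub_left x).mul_const M
  have hI : ∫ y, φ.normed volume (x - y) * M = M := by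
    rw [integral_mul_const, integral_sub_left_eq_self (fun y => φ.normed volume y) volume x,
      φ.integral_normed, one_mul]
  rw [← hI]
  refine norm_integral_le_of_norm_le hint (h.mono fun y hy => ?_)
  rw [norm_smul, Real.norm_eq_abs, abs_of_nonneg (φ.nonneg_normed _)]
  by_cases hb : y ∈ Metric.ball x φ.rOut
  · exact mul_le_mul_of_nonneg_left (hy hb) (φ.nonneg_normed _)
  · have : φ.normed volume (x - y) = 0 := by
      have : x - y ∉ Function.support (φ.normed volume) := by
        rw [φ.support_normed_eq]
        simpa [dist_eq_norm, norm_sub_rev] using hb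
      simpa using this
    rw [this, zero_mul, zero_mul]

/-- Bump functions whose supports shrink to the origin. -/
noncomputable def shrinkingBump (d : ℕ) (n : ℕ) : ContDiffBump (0 : Space d) where
  rIn := 1 / (n + 1)
  rOut := 2 * (1 / (n + 1))
  rIn_pos := by positivity
  rIn_lt_rOut := by
    have : (0 : ℝ) < 1 / (n + 1) := by positivity
    linarith

theorem tendsto_shrinkingBump_rOut (d : ℕ) :
    Tendsto (fun n => (shrinkingBump d n).rOut) atTop (𝓝 0) := by
  have := (tendsto_one_div_add_atTop_nhds_zero_nat (𝕜 := ℝ)).const_mul 2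
  simpa [shrinkingBump] using this

variable [CompleteSpace F]

theorem tendsto_mollify_of_continuous (hf : Continuous f) (x : Space d) :
    Tendsto (fun n => mollify (shrinkingBump d n) f x) atTop (𝓝 (f x)) :=
  ContDiffBump.convolution_tendsto_right_of_continuous (tendsto_shrinkingBump_rOut d) hf x

theorem ae_tendsto_mollify (hf : LocallyIntegrable f volume) :
    ∀ᵐ x, Tendsto (fun n => mollify (shrinkingBump d n) f x) atTop (𝓝 (f x)) :=
  ContDiffBump.ae_convolution_tendsto_right_of_locallyIntegrable (K := 2)
    (tendsto_shrinkingBump_rOut d) (Eventually.of_forall fun _ => le_rfl) hf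

theorem HasWeakGrad.norm_mollify_sub_le (h : HasWeakGrad f G) {U : Set (Space d)}
    (hU : Convex ℝ U) {δ M : ℝ} (hM : ∀ᵐ y, y ∈ Metric.thickening δ U → ‖G y‖ ≤ M)
    {φ : ContDiffBump (0 : Space d)} (hφ : φ.rOut ≤ δ) {x y : Space d} (hx : x ∈ U) (hy : y ∈ U) :
    ‖mollify φ f y - mollify φ f x‖ ≤ M * ‖y - x‖ := by
  refine hU.norm_image_sub_le_of_norm_hasFDerivWithin_le
    (fun z _ => (h.hasFDerivAt_mollify φ z).hasFDerivWithinAt) (fun z hz => ?_) hx hy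
  refine norm_mollify_le φ (hM.mono fun w hw hwz => hw ?_)
  exact Metric.mem_thickening_iff.2 ⟨z, hz, (Metric.mem_ball.1 hwz).trans_le hφ⟩

/-- A continuous function is Lipschitz on a convex set with the constant given by a bound on the
weak gradient in a neighbourhood of the set. -/
theorem HasWeakGrad.norm_sub_le_of_continuous (h : HasWeakGrad f G) (hf : Continuous f)
    {U : Set (Space d)} (hU : Convex ℝ U) {δ M : ℝ} (hδ : 0 < δ)
    (hM : ∀ᵐ y, y ∈ Metric.thickening δ U → ‖G y‖ ≤ M) {x y : Space d} (hx : x ∈ U) (hy : y ∈ U) :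
    ‖f y - f x‖ ≤ M * ‖y - x‖ := by
  refine le_of_tendsto ((tendsto_mollify_of_continuous hf y).sub
    (tendsto_mollify_of_continuous hf x)).norm ?_
  filter_upwards [(tendsto_shrinkingBump_rOut d).eventually (Iio_mem_nhds hδ)] with n hn
  exact h.norm_mollify_sub_le hU hM (le_of_lt hn) hx hy

/-- A function with bounded weak gradient has a Lipschitz representative. -/
theorem HasWeakGrad.exists_lipschitz [FiniteDimensional ℝ F] (h : HasWeakGrad f G)
    (hG : MemLp G ∞ volume) : ∃ (C : NNReal) (g : Space d → F), LipschitzWith C g ∧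
      f =ᵐ[volume] g := by
  set M : ℝ := (eLpNormEssSup G volume).toReal with hM
  have hfin : eLpNormEssSup G volume ≠ ∞ := by
    have := hG.2
    rw [eLpNorm_exponent_top] at this
    exact this.ne
  have hb : ∀ᵐ y, y ∈ Metric.thickening 2 (Set.univ : Set (Space d)) → ‖G y‖ ≤ M := by
    filter_upwards [ae_le_eLpNormEssSup (f := G) (μ := volume)] with y hy _
    rw [← toReal_enorm]
    exact ENNReal.toReal_mono hfin hy
  have hlim := ae_tendsto_mollify h.locInt
  have hL : LipschitzOnWith (Real.toNNReal M) f
      {x | Tendsto (fun n => mollify (shrinkingBump d n) f x) atTop (𝓝 (f x))} := by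
    refine LipschitzOnWith.of_dist_le_mul fun x hx y hy => ?_
    rw [Real.coe_toNNReal _ ENNReal.toReal_nonneg, dist_eq_norm, dist_eq_norm]
    refine le_of_tendsto (hx.sub hy).norm ?_
    filter_upwards [(tendsto_shrinkingBump_rOut d).eventually
      (Iio_mem_nhds (zero_lt_two (α := ℝ)))] with n hn
    exact h.norm_mollify_sub_le convex_univ hb (le_of_lt hn) trivial trivial
  obtain ⟨g, hg, hgf⟩ := hL.extend_finite_dimension
  exact ⟨_, g, hg, hlim.mono fun x hx => hgf hx⟩

/-- A continuous function whose weak gradient is Lipschitz is differentiable. -/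
theorem HasWeakGrad.hasFDerivAt_of_lipschitz (h : HasWeakGrad f G) (hf : Continuous f)
    {C : NNReal} {g : Space d → Space d →L[ℝ] F} (hg : LipschitzWith C g)
    (hGg : G =ᵐ[volume] g) (x : Space d) : HasFDerivAt f (g x) x := by
  refine hasFDerivAt_of_tendstoUniformly (l := atTop)
    (f := fun n => mollify (shrinkingBump d n) f)
    (f' := fun n => mollify (shrinkingBump d n) g) ?_
    (fun n y => by
      rw [← mollify_congr _ hGg]
      exact h.hasFDerivAt_mollify _ y)
    (fun y => tendsto_mollify_of_continuous hf y) x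
  rw [Metric.tendstoUniformly_iff]
  intro ε hε
  have hlim : Tendsto (fun n => (C : ℝ) * (shrinkingBump d n).rOut) atTop (𝓝 0) := by
    simpa using (tendsto_shrinkingBump_rOut d).const_mul (C : ℝ)
  filter_upwards [hlim.eventually (Iio_mem_nhds hε)] with n hn y
  rw [dist_comm]
  refine (ContDiffBump.dist_normed_convolution_le hg.continuous.aestronglyMeasurable
    (fun z hz => ?_)).trans_lt hn
  exact (hg.dist_le_mul z y).trans (mul_le_mul_of_nonneg_left (Metric.mem_ball.1 hz).le C.2)

/-- The `L^∞` norm on a set bounds a continuous representative at interior points of the set. -/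
theorem enorm_le_supNormOn {F : Type*} [NormedAddCommGroup F] {g H : Space d → F}
    (hH : Continuous H) (hgH : g =ᵐ[volume] H) {s : Set (Space d)} {y : Space d}
    (hy : y ∈ interior s) : ‖H y‖ₑ ≤ supNormOn g s := by
  by_contra! hlt
  have hopen : IsOpen ({z | supNormOn g s < ‖H z‖ₑ} ∩ interior s) :=
    (isOpen_lt continuous_const hH.enorm).inter isOpen_interior
  have hpos := hopen.measure_pos volume ⟨y, hlt, hy⟩
  have hae : ∀ᵐ z ∂(volume.restrict (interior s)), ‖g z‖ₑ ≤ supNormOn g s := by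
    refine ae_mono (Measure.restrict_mono_set volume interior_subset) ?_
    rw [supNormOn, eLpNorm_exponent_top]
    exact ae_le_eLpNormEssSup
  rw [ae_restrict_iff' isOpen_interior.measurableSet] at hae
  refine hpos.ne' (measure_mono_null ?_ (hae.and hgH))
  rintro z ⟨hz1, hz2⟩ ⟨hz3, hz4⟩
  exact absurd (hz3 hz2) (by rw [hz4]; exact not_le_of_gt hz1)

theorem ae_norm_le_supNormOn {F : Type*} [NormedAddCommGroup F] {g : Space d → F}
    (hg : MemLp g ∞ volume) {U : Set (Space d)} (hU : IsOpen U) {s : Set (Space d)} (hUs : U ⊆ s) :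
    ∀ᵐ y, y ∈ U → ‖g y‖ ≤ (supNormOn g s).toReal := by
  have hae : ∀ᵐ z ∂(volume.restrict U), ‖g z‖ₑ ≤ supNormOn g s := by
    refine ae_mono (Measure.restrict_mono_set volume hUs) ?_
    rw [supNormOn, eLpNorm_exponent_top]
    exact ae_le_eLpNormEssSup
  rw [ae_restrict_iff' hU.measurableSet] at hae
  refine hae.mono fun y hy hyU => ?_
  rw [← toReal_enorm]
  exact ENNReal.toReal_mono (hg.restrict s).2.ne (hy hyU)

/-- A function in `Ẇ^{3,∞}` is twice differentiable, with continuous second derivative whose weak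
gradient is the third weak derivative. -/
theorem IsHomSobolevThree.exists_deriv {u : Space d → Space d}
    {G₁ : Space d → Space d →L[ℝ] Space d}
    {G₂ : Space d → Space d →L[ℝ] Space d →L[ℝ] Space d}
    {G₃ : Space d → Space d →L[ℝ] Space d →L[ℝ] Space d →L[ℝ] Space d}
    (h : IsHomSobolevThree u G₁ G₂ G₃) :
    ∃ (H₁ : Space d → Space d →L[ℝ] Space d)
      (H₂ : Space d → Space d →L[ℝ] Space d →L[ℝ] Space d),
      (∀ x, HasFDerivAt u (H₁ x) x) ∧ (∀ x, HasFDerivAt H₁ (H₂ x) x) ∧ Continuous H₁ ∧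
      Continuous H₂ ∧ G₁ =ᵐ[volume] H₁ ∧ G₂ =ᵐ[volume] H₂ ∧ HasWeakGrad H₂ G₃ := by
  obtain ⟨C₁, H₁, hL₁, he₁⟩ := h.grad₂.exists_lipschitz h.bdd₂
  obtain ⟨C₂, H₂, hL₂, he₂⟩ := h.grad₃.exists_lipschitz h.bdd₃
  exact ⟨H₁, H₂, h.grad₁.hasFDerivAt_of_lipschitz h.cont hL₁ he₁,
    (h.grad₂.congr he₁ (EventuallyEq.refl _ _)).hasFDerivAt_of_lipschitz hL₁.continuous hL₂ he₂,
    hL₁.continuous, hL₂.continuous, he₁, he₂, h.grad₃.congr he₂ (EventuallyEq.refl _ _)⟩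

end Sobolev

/-! ### Neighbourhoods of parallelograms -/

section Geometry

variable {d : ℕ}

/-- The open `R`-neighbourhood of the parallelogram `{a v + b w : |a| ≤ 1, |b| ≤ 1}`. -/
def parNhd (R : ℝ) (v w : Space d) : Set (Space d) :=
  {y | ∃ a b : ℝ, |a| ≤ 1 ∧ |b| ≤ 1 ∧ ‖y - (a • v + b • w)‖ < R}

theorem isOpen_parNhd (R : ℝ) (v w : Space d) : IsOpen (parNhd R v w) := by
  have : parNhd R v w = ⋃ (a : ℝ) (b : ℝ) (_ : |a| ≤ 1) (_ : |b| ≤ 1),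
      Metric.ball (a • v + b • w) R := by
    ext y
    simp only [parNhd, Set.mem_ofPred_eq, Set.mem_iUnion, Metric.mem_ball, dist_eq_norm, exists_prop]
  rw [this]
  exact isOpen_iUnion fun a => isOpen_iUnion fun b => isOpen_iUnion fun _ =>
    isOpen_iUnion fun _ => Metric.isOpen_ball

theorem parNhd_mono {R R' : ℝ} (h : R ≤ R') (v w : Space d) : parNhd R v w ⊆ parNhd R' v w :=
  fun _ ⟨a, b, ha, hb, hy⟩ => ⟨a, b, ha, hb, hy.trans_le h⟩

theorem parNhd_comm (R : ℝ) (v w : Space d) : parNhd R v w = parNhd R w v := by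
  ext y
  constructor <;> rintro ⟨a, b, ha, hb, hy⟩ <;> exact ⟨b, a, hb, ha, by rwa [add_comm]⟩

theorem parNhd_neg_vec (R : ℝ) (v w : Space d) : parNhd R (-v) (-w) = parNhd R v w := by
  ext y
  constructor <;> rintro ⟨a, b, ha, hb, hy⟩ <;>
    exact ⟨-a, -b, by rwa [abs_neg], by rwa [abs_neg], by simpa using hy⟩

theorem neg_parNhd (R : ℝ) (v w : Space d) : -parNhd R v w = parNhd R v w := by
  have : ∀ y, y ∈ parNhd R v w → -y ∈ parNhd R v w := by
    rintro y ⟨a, b, ha, hb, hy⟩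
    refine ⟨-a, -b, by rwa [abs_neg], by rwa [abs_neg], ?_⟩
    have e : -y - (-a • v + -b • w) = -(y - (a • v + b • w)) := by module
    rwa [e, norm_neg]
  ext y
  rw [Set.mem_neg]
  exact ⟨fun h => by simpa using this _ h, this y⟩

theorem convex_parNhd (R : ℝ) (v w : Space d) : Convex ℝ (parNhd R v w) := by
  rintro y ⟨a, b, ha, hb, hy⟩ y' ⟨a', b', ha', hb', hy'⟩ s t hs ht hst
  have conv : ∀ p q : ℝ, |p| ≤ 1 → |q| ≤ 1 → |s * p + t * q| ≤ 1 := by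
    intro p q hp hq
    rw [abs_le] at hp hq ⊢
    constructor <;> nlinarith
  refine ⟨s * a + t * a', s * b + t * b', conv _ _ ha ha', conv _ _ hb hb', ?_⟩
  have e : s • y + t • y' - ((s * a + t * a') • v + (s * b + t * b') • w) =
      s • (y - (a • v + b • w)) + t • (y' - (a' • v + b' • w)) := by module
  have := convex_ball (0 : Space d) R (mem_ball_zero_iff.2 hy) (mem_ball_zero_iff.2 hy') hs ht hst
  rw [e]
  exact mem_ball_zero_iff.1 this

theorem zero_mem_parNhd {R : ℝ} (hR : 0 < R) (v w : Space d) : (0 : Space d) ∈ parNhd R v w :=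
  ⟨0, 0, by simp, by simp, by simpa using hR⟩

theorem parNhd_subset_ball {R : ℝ} (hR : 0 < R) {v w : Space d} (hv : 1 ≤ ‖v‖) :
    parNhd R v w ⊆ Metric.ball 0 ((R + 1) * (‖v‖ + ‖w‖)) := by
  rintro y ⟨a, b, ha, hb, hy⟩
  rw [mem_ball_zero_iff]
  have h1 : ‖a • v + b • w‖ ≤ ‖v‖ + ‖w‖ := by
    refine (norm_add_le _ _).trans ?_
    rw [norm_smul, norm_smul, Real.norm_eq_abs, Real.norm_eq_abs]
    have := mul_le_mul_of_nonneg_right ha (norm_nonneg v)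
    have := mul_le_mul_of_nonneg_right hb (norm_nonneg w)
    linarith
  have h2 : ‖y‖ ≤ ‖y - (a • v + b • w)‖ + ‖a • v + b • w‖ := by
    simpa using norm_add_le (y - (a • v + b • w)) (a • v + b • w)
  nlinarith [norm_nonneg w]

theorem thickening_parNhd_subset (R δ : ℝ) (v w : Space d) :
    Metric.thickening δ (parNhd R v w) ⊆ parNhd (R + δ) v w := by
  intro y hy
  obtain ⟨z, ⟨a, b, ha, hb, hz⟩, hyz⟩ := Metric.mem_thickening_iff.1 hy
  refine ⟨a, b, ha, hb, ?_⟩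
  rw [dist_eq_norm] at hyz
  calc _ = ‖(y - z) + (z - (a • v + b • w))‖ := by congr 1; abel
    _ ≤ ‖y - z‖ + ‖z - (a • v + b • w)‖ := norm_add_le _ _
    _ < R + δ := by linarith

theorem crossNorm_comm (v w : Space d) : crossNorm v w = crossNorm w v := by
  unfold crossNorm
  rw [real_inner_comm, mul_comm]

/-- The area of a parallelogram is the base times the height. -/
theorem crossNorm_eq {v : Space d} (hv : v ≠ 0) (w : Space d) :
    crossNorm v w = ‖v‖ * ‖w - (inner ℝ v w / ‖v‖ ^ 2) • v‖ := by
  have hv' : ‖v‖ ≠ 0 := norm_ne_zero_iff.2 hv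
  unfold crossNorm
  have e : ‖v‖ ^ 2 * ‖w‖ ^ 2 - inner ℝ v w ^ 2 =
      (‖v‖ * ‖w - (inner ℝ v w / ‖v‖ ^ 2) • v‖) ^ 2 := by
    rw [mul_pow, norm_sub_sq_real, inner_smul_right, norm_smul, Real.norm_eq_abs, mul_pow, sq_abs,
      real_inner_comm w v]
    field_simp
    ring
  rw [e, Real.sqrt_sq (by positivity)]

/-- Volume bound when the first vector is the longer one. With `w'` the component of `w` orthogonal
to `v`, the parallelogram is contained in `{s v + t w' : |s| ≤ 2, |t| ≤ 1}`. The points of a grid in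
this rectangle with mesh size at most `1` along both sides number at most
`9 ‖v‖ (2 ‖w'‖ + 5) ≤ 45 (‖v‖ ‖w'‖ + ‖v‖)`, and the balls of radius `R + 2` around them cover the
neighbourhood. -/
theorem volume_parNhd_le_of_le {R : ℝ} {v w : Space d} (hv : 1 ≤ ‖v‖)
    (hwv : ‖w‖ ≤ ‖v‖) :
    volume (parNhd R v w) ≤ ENNReal.ofReal (45 * (crossNorm v w + ‖v‖)) *
      volume (Metric.ball (0 : Space d) (R + 2)) := by
  have hv0 : v ≠ 0 := by
    rintro rfl
    norm_num at hv
  have hvpos : 0 < ‖v‖ := by linarith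
  set s : ℝ := inner ℝ v w / ‖v‖ ^ 2 with hs
  set w' := w - s • v with hw'
  have hs1 : |s| ≤ 1 := by
    rw [hs, abs_div, abs_of_pos (by positivity : 0 < ‖v‖ ^ 2), div_le_one (by positivity)]
    refine (abs_real_inner_le_norm v w).trans ?_
    nlinarith
  set N : ℕ := ⌈‖v‖⌉₊ with hN
  set M : ℕ := ⌈‖w'‖⌉₊ + 1 with hM
  have hNv : ‖v‖ ≤ N := Nat.le_ceil _
  have hNv' : (N : ℝ) ≤ 2 * ‖v‖ := by
    have := (Nat.ceil_lt_add_one hvpos.le).le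
    linarith
  have hMw : ‖w'‖ ≤ M := by
    have := Nat.le_ceil ‖w'‖
    rw [hM]; push_cast; linarith
  have hMw' : (M : ℝ) ≤ ‖w'‖ + 2 := by
    have := (Nat.ceil_lt_add_one (norm_nonneg w')).le
    rw [hM]; push_cast; linarith
  have hNpos : (0 : ℝ) < N := hvpos.trans_le hNv
  have hMpos : (0 : ℝ) < M := by rw [hM]; positivity
  let I : Finset (ℤ × ℤ) := Finset.Icc (-(2 * N : ℤ)) (2 * N) ×ˢ Finset.Icc (-(M : ℤ)) M
  let pt : ℤ × ℤ → Space d := fun q => ((q.1 : ℝ) / N) • v + ((q.2 : ℝ) / M) • w'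
  -- rounding down to the grid `(1/N) ℤ`
  have round : ∀ (n m : ℕ), (0 : ℝ) < n → ∀ t : ℝ, |t| ≤ m → ∃ i : ℤ,
      i ∈ Finset.Icc (-(m * n : ℤ)) (m * n) ∧ |t - i / n| ≤ 1 / n := by
    intro n m hn t ht
    rw [abs_le] at ht
    refine ⟨⌊t * n⌋, ?_, ?_⟩
    · rw [Finset.mem_Icc]
      constructor
      · rw [Int.le_floor]
        push_cast
        nlinarith
      · have h1 : (⌊t * n⌋ : ℝ) ≤ t * n := Int.floor_le _
        have h2 : t * n ≤ m * n := by nlinarith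
        exact_mod_cast h1.trans h2
    · have h1 : (⌊t * n⌋ : ℝ) ≤ t * n := Int.floor_le _
      have h2 : t * n < ⌊t * n⌋ + 1 := Int.lt_floor_add_one _
      have e : t - ⌊t * n⌋ / n = (t * n - ⌊t * n⌋) / n := by field_simp
      rw [e, abs_div, abs_of_pos hn, abs_of_nonneg (by linarith)]
      gcongr
      linarith
  have hcov : parNhd R v w ⊆ ⋃ q ∈ I, Metric.ball (pt q) (R + 2) := by
    rintro y ⟨a, b, ha, hb, hy⟩
    have hab : |a + b * s| ≤ (2 : ℕ) := by
      have h1 : |b * s| ≤ 1 := by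
        rw [abs_mul]
        exact mul_le_one₀ hb (abs_nonneg _) hs1
      have := abs_add_le a (b * s)
      push_cast
      linarith
    obtain ⟨i, hi, hi'⟩ := round N 2 hNpos (a + b * s) hab
    obtain ⟨j, hj, hj'⟩ := round M 1 hMpos b (by simpa using hb)
    simp only [Set.mem_iUnion]
    refine ⟨(i, j), ?_, ?_⟩
    · simp only [I, Finset.mem_product]
      exact ⟨by simpa using hi, by simpa using hj⟩
    · rw [Metric.mem_ball, dist_eq_norm]
      have e : y - pt (i, j) = (y - (a • v + b • w)) +
          ((a + b * s - i / N) • v + (b - j / M) • w') := by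
        simp only [pt, hw']
        module
      have h1 : ‖(a + b * s - i / N) • v‖ ≤ 1 := by
        rw [norm_smul, Real.norm_eq_abs]
        calc _ ≤ 1 / (N : ℝ) * N := by gcongr
          _ = 1 := by field_simp
      have h2 : ‖(b - j / M) • w'‖ ≤ 1 := by
        rw [norm_smul, Real.norm_eq_abs]
        calc _ ≤ 1 / (M : ℝ) * M := by gcongr
          _ = 1 := by field_simp
      rw [e]
      refine (norm_add_le _ _).trans_lt ?_
      have := norm_add_le ((a + b * s - i / N) • v) ((b - j / M) • w')
      linarith
  refine (measure_mono hcov).trans ((measure_biUnion_finset_le _ _).trans ?_)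
  simp_rw [Measure.addHaar_ball_center]
  rw [Finset.sum_const, nsmul_eq_mul]
  gcongr
  have hcard : (I.card : ℝ) = (4 * N + 1) * (2 * M + 1) := by
    simp only [I, Finset.card_product, Int.card_Icc]
    have h1 : (2 * (N : ℤ) + 1 - -(2 * N)).toNat = 4 * N + 1 := by omega
    have h2 : ((M : ℤ) + 1 - -M).toNat = 2 * M + 1 := by omega
    rw [h1, h2]
    push_cast
    ring
  rw [← ENNReal.ofReal_natCast]
  apply ENNReal.ofReal_le_ofReal
  rw [hcard, crossNorm_eq hv0]
  change _ ≤ 45 * (‖v‖ * ‖w'‖ + ‖v‖)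
  have h1 : (4 * N + 1 : ℝ) ≤ 9 * ‖v‖ := by linarith
  have h2 : (2 * M + 1 : ℝ) ≤ 2 * ‖w'‖ + 5 := by linarith
  have hw0 := norm_nonneg w'
  calc _ ≤ (9 * ‖v‖) * (2 * ‖w'‖ + 5) := by gcongr
    _ ≤ _ := by nlinarith [mul_nonneg hvpos.le hw0]

theorem volume_parNhd_le {R : ℝ} {v w : Space d} (hv : 1 ≤ ‖v‖) (hw : 1 ≤ ‖w‖) :
    volume (parNhd R v w) ≤
      ENNReal.ofReal (45 * (volume (Metric.ball (0 : Space d) (R + 2))).toReal *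
        (crossNorm v w + ‖v‖ + ‖w‖)) := by
  have hfin : volume (Metric.ball (0 : Space d) (R + 2)) ≠ ∞ := measure_ball_lt_top.ne
  have main : ∀ v w : Space d, 1 ≤ ‖v‖ → ‖w‖ ≤ ‖v‖ → volume (parNhd R v w) ≤
      ENNReal.ofReal (45 * (volume (Metric.ball (0 : Space d) (R + 2))).toReal *
        (crossNorm v w + ‖v‖ + ‖w‖)) := by
    intro v w hv hwv
    refine (volume_parNhd_le_of_le hv hwv).trans ?_
    rw [← ENNReal.ofReal_toReal hfin, ← ENNReal.ofReal_mul
      (by have : 0 ≤ crossNorm v w := Real.sqrt_nonneg _; positivity)]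
    rw [ENNReal.toReal_ofReal ENNReal.toReal_nonneg]
    apply ENNReal.ofReal_le_ofReal
    have h0 : 0 ≤ (volume (Metric.ball (0 : Space d) (R + 2))).toReal := ENNReal.toReal_nonneg
    nlinarith [norm_nonneg w, mul_nonneg h0 (norm_nonneg w)]
  rcases le_total ‖w‖ ‖v‖ with h | h
  · exact main v w hv h
  · rw [parNhd_comm, crossNorm_comm, add_right_comm]
    exact main w v hw h

end Geometry

/-! ### Moments of the localisation weights -/

section Nodal

variable {d : ℕ} {ζ : Space d → ℝ}

theorem IsNodalBasis.exists_radius (hζ : IsNodalBasis ζ) :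
    ∃ R : ℝ, 0 < R ∧ ∀ y, ζ y ≠ 0 → ‖y‖ < R := by
  obtain ⟨R, hR⟩ := hζ.compact.isCompact.isBounded.subset_ball 0
  refine ⟨max R 1, by positivity, fun y hy => ?_⟩
  have := hR (subset_tsupport ζ hy)
  exact (mem_ball_zero_iff.1 this).trans_le (le_max_left _ _)

theorem finite_site_norm_le (r : ℝ) (x : Space d) : {ξ : Site d | ‖Site.pt ξ - x‖ ≤ r}.Finite := by
  have hsub : {ξ : Site d | ‖Site.pt ξ - x‖ ≤ r} ⊆
      Set.pi Set.univ fun i => Set.Icc ⌊x i - r⌋ ⌈x i + r⌉ := by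
    intro ξ hξ i _
    have h := (PiLp.norm_apply_le (Site.pt ξ - x) i).trans hξ
    have e : (Site.pt ξ - x) i = (ξ i : ℝ) - x i := rfl
    rw [e, Real.norm_eq_abs, abs_le] at h
    constructor
    · have : (⌊x i - r⌋ : ℝ) ≤ ξ i := (Int.floor_le _).trans (by linarith)
      exact_mod_cast this
    · have : (ξ i : ℝ) ≤ ⌈x i + r⌉ := le_trans (by linarith) (Int.le_ceil _)
      exact_mod_cast this
  exact (Set.Finite.pi' fun i => Set.finite_Icc _ _).subset fun ξ hξ i => hsub hξ i trivial

theorem chi_nonneg (hζ : IsNodalBasis ζ) (ξ : Site d) (ρ : Dir d) (x : Space d) :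
    0 ≤ chi ζ ξ ρ x :=
  intervalIntegral.integral_nonneg zero_le_one fun _ _ => hζ.nonneg _

theorem exists_of_chi_ne_zero {R : ℝ} (hR : ∀ y, ζ y ≠ 0 → ‖y‖ < R) {ξ : Site d} {ρ : Dir d}
    {x : Space d} (h : chi ζ ξ ρ x ≠ 0) :
    ∃ t ∈ Set.Icc (0 : ℝ) 1, ‖Site.pt ξ + t • ρ.vec - x‖ < R := by
  by_contra! hc
  apply h
  unfold chi
  rw [intervalIntegral.integral_congr (g := fun _ => (0 : ℝ))]
  · simp
  · intro t ht
    rw [Set.uIcc_of_le zero_le_one] at ht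
    by_contra h0
    exact absurd (hR _ h0) (not_lt_of_ge (hc t ht))

/-- The weights `χ_{ξ,ρ}(x)` vanish for all but finitely many `ξ`, and reproduce affine functions
up to the shift by the midpoint of the bond. -/
theorem IsNodalBasis.exists_finset_chi (hζ : IsNodalBasis ζ) (ρ : Dir d) (x : Space d) :
    ∃ s : Finset (Site d), (∀ ξ ∉ s, chi ζ ξ ρ x = 0) ∧
      (∑ ξ ∈ s, chi ζ ξ ρ x = 1) ∧
      (∑ ξ ∈ s, chi ζ ξ ρ x • (Site.pt ξ - x) = -(1 / 2 : ℝ) • ρ.vec) := by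
  obtain ⟨R, hR0, hR⟩ := hζ.exists_radius
  have hfin := finite_site_norm_le (R + ‖ρ.vec‖) x
  set s := hfin.toFinset with hs
  have hout : ∀ ξ ∉ s, ∀ t ∈ Set.Icc (0 : ℝ) 1, ζ (Site.pt ξ + t • ρ.vec - x) = 0 := by
    intro ξ hξ t ht
    by_contra h0
    apply hξ
    rw [hs, Set.Finite.mem_toFinset]
    have h1 := hR _ h0
    have h2 : ‖t • ρ.vec‖ ≤ ‖ρ.vec‖ := by
      rw [norm_smul, Real.norm_eq_abs, abs_of_nonneg ht.1]
      exact mul_le_of_le_one_left (norm_nonneg _) ht.2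
    have e : Site.pt ξ - x = (Site.pt ξ + t • ρ.vec - x) - t • ρ.vec := by abel
    change ‖Site.pt ξ - x‖ ≤ _
    rw [e]
    exact (norm_sub_le _ _).trans (by linarith)
  have hchi0 : ∀ ξ ∉ s, chi ζ ξ ρ x = 0 := by
    intro ξ hξ
    unfold chi
    rw [intervalIntegral.integral_congr (g := fun _ => (0 : ℝ))]
    · simp
    · intro t ht
      rw [Set.uIcc_of_le zero_le_one] at ht
      exact hout ξ hξ t ht
  have key : ∀ (a : ℝ) (b : Space d), ∑ ξ ∈ s, (a + inner ℝ b (Site.pt ξ)) * chi ζ ξ ρ x =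
      a + inner ℝ b x - 1 / 2 * inner ℝ b ρ.vec := by
    intro a b
    have hpt : ∀ t ∈ Set.Icc (0 : ℝ) 1,
        ∑ ξ ∈ s, (a + inner ℝ b (Site.pt ξ)) * ζ (Site.pt ξ + t • ρ.vec - x) =
        a + inner ℝ b x - t * inner ℝ b ρ.vec := by
      intro t ht
      have h := hζ.affine a b (x - t • ρ.vec)
      have e : ∀ ξ : Site d, ζ (x - t • ρ.vec - Site.pt ξ) = ζ (Site.pt ξ + t • ρ.vec - x) := by
        intro ξ
        rw [← hζ.even]
        congr 1
        abel
      simp_rw [e] at h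
      rw [tsum_eq_sum (s := s) fun ξ hξ => by rw [hout ξ hξ t ht, mul_zero]] at h
      rw [h, inner_sub_right, inner_smul_right]
      ring
    have hint : ∀ ξ ∈ s, IntervalIntegrable
        (fun t : ℝ => (a + inner ℝ b (Site.pt ξ)) * ζ (Site.pt ξ + t • ρ.vec - x))
        volume 0 1 := by
      intro ξ _
      refine Continuous.intervalIntegrable ?_ _ _
      have := hζ.cont
      fun_prop
    calc _ = ∑ ξ ∈ s, ∫ t in (0 : ℝ)..1,
          (a + inner ℝ b (Site.pt ξ)) * ζ (Site.pt ξ + t • ρ.vec - x) := by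
          refine Finset.sum_congr rfl fun ξ _ => ?_
          rw [intervalIntegral.integral_const_mul, chi]
      _ = ∫ t in (0 : ℝ)..1, ∑ ξ ∈ s,
          (a + inner ℝ b (Site.pt ξ)) * ζ (Site.pt ξ + t • ρ.vec - x) :=
          (intervalIntegral.integral_finsetSum hint).symm
      _ = ∫ t in (0 : ℝ)..1, (a + inner ℝ b x - t * inner ℝ b ρ.vec) := by
          refine intervalIntegral.integral_congr fun t ht => ?_
          rw [Set.uIcc_of_le zero_le_one] at ht
          exact hpt t ht
      _ = _ := by
          rw [intervalIntegral.integral_sub (by simp)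
            (Continuous.intervalIntegrable (by fun_prop) _ _), intervalIntegral.integral_mul_const]
          simp [integral_id]
  refine ⟨s, hchi0, by simpa using key 1 0, ?_⟩
  refine ext_inner_left ℝ fun b => ?_
  rw [inner_sum, inner_smul_right]
  have h := key (-inner ℝ b x) b
  rw [neg_add_cancel, zero_sub, ← neg_mul] at h
  rw [← h]
  refine Finset.sum_congr rfl fun ξ _ => ?_
  rw [inner_smul_right, inner_sub_right]
  ring

end Nodal

/-! ### Local Taylor estimates for the displacement -/

section Taylor

variable {E F : Type*} [NormedAddCommGroup E] [NormedSpace ℝ E] [NormedAddCommGroup F]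
  [NormedSpace ℝ F] {u : E → F} {H₁ : E → E →L[ℝ] F} {H₂ : E → E →L[ℝ] E →L[ℝ] F}

/-- First-order expansion about `x` of the finite difference `u (y + v) - u y`. -/
theorem norm_sub_sub_le_of_deriv_two (h₁ : ∀ x, HasFDerivAt u (H₁ x) x)
    (h₂ : ∀ x, HasFDerivAt H₁ (H₂ x) x) {U : Set E} (hU : Convex ℝ U) {N r : ℝ}
    (hN : ∀ z ∈ U, ‖H₂ z‖ ≤ N) {x y v : E} (hx : x ∈ U) (hy : y ∈ U) (hyv : y + v ∈ U)
    (hr : ‖y - x‖ + ‖v‖ ≤ r) :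
    ‖u (y + v) - u y - H₁ x v‖ ≤ N * r * ‖v‖ := by
  have hN0 : 0 ≤ N := (norm_nonneg _).trans (hN x hx)
  have hr1 : ‖y - x‖ ≤ r := by linarith [norm_nonneg v]
  have hr2 : ‖y + v - x‖ ≤ r := by
    have e : y + v - x = (y - x) + v := by abel
    rw [e]
    exact (norm_add_le _ _).trans hr
  have hC : Convex ℝ (U ∩ Metric.closedBall x r) := hU.inter (convex_closedBall x r)
  have := hC.norm_image_sub_le_of_norm_hasFDerivWithin_le (C := N * r)
    (f := fun z => u z - H₁ x z) (f' := fun z => H₁ z - H₁ x)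
    (fun z _ => ((h₁ z).sub (H₁ x).hasFDerivAt).hasFDerivWithinAt) (fun z hz => ?_)
    (x := y) (y := y + v) ⟨hy, by simpa [dist_eq_norm] using hr1⟩
    ⟨hyv, by simpa [dist_eq_norm] using hr2⟩
  · rw [add_sub_cancel_left] at this
    convert this using 2
    rw [map_add]
    abel
  · refine (hU.norm_image_sub_le_of_norm_hasFDerivWithin_le (f := H₁) (f' := H₂)
      (fun w _ => (h₂ w).hasFDerivWithinAt) hN hx hz.1).trans ?_
    exact mul_le_mul_of_nonneg_left (by simpa [dist_eq_norm] using hz.2) hN0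

/-- Second-order expansion about `x` of the finite difference `u (y + v) - u y`. -/
theorem norm_sub_sub_sub_le_of_lipschitz (h₁ : ∀ x, HasFDerivAt u (H₁ x) x)
    (h₂ : ∀ x, HasFDerivAt H₁ (H₂ x) x) {U : Set E} (hU : Convex ℝ U) {M r : ℝ} (hM0 : 0 ≤ M)
    {x y v : E} (hM : ∀ z ∈ U, ‖H₂ z - H₂ x‖ ≤ M * ‖z - x‖) (hx : x ∈ U) (hy : y ∈ U)
    (hyv : y + v ∈ U) (hr : ‖y - x‖ + ‖v‖ ≤ r) :
    ‖u (y + v) - u y - H₁ x v - H₂ x (y - x) v - (1 / 2 : ℝ) • H₂ x v v‖ ≤ M * r ^ 2 * ‖v‖ := by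
  have hr0 : 0 ≤ r := by linarith [norm_nonneg v, norm_nonneg (y - x)]
  have hr1 : ‖y - x‖ ≤ r := by linarith [norm_nonneg v]
  have hr2 : ‖y + v - x‖ ≤ r := by
    have e : y + v - x = (y - x) + v := by abel
    rw [e]
    exact (norm_add_le _ _).trans hr
  have hC : Convex ℝ (U ∩ Metric.closedBall x r) := hU.inter (convex_closedBall x r)
  have hyC : y ∈ U ∩ Metric.closedBall x r := ⟨hy, by simpa [dist_eq_norm] using hr1⟩
  have hyvC : y + v ∈ U ∩ Metric.closedBall x r := ⟨hyv, by simpa [dist_eq_norm] using hr2⟩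
  have hrem : ∀ z ∈ U ∩ Metric.closedBall x r, ‖H₁ z - H₁ x - H₂ x (z - x)‖ ≤ M * r ^ 2 := by
    intro z hz
    have hzx : ‖z - x‖ ≤ r := by simpa [dist_eq_norm] using hz.2
    have := hC.norm_image_sub_le_of_norm_hasFDerivWithin_le (C := M * r)
      (f := fun z => H₁ z - H₂ x z) (f' := fun z => H₂ z - H₂ x)
      (fun w _ => ((h₂ w).sub (H₂ x).hasFDerivAt).hasFDerivWithinAt)
      (fun w hw => (hM w hw.1).trans
        (mul_le_mul_of_nonneg_left (by simpa [dist_eq_norm] using hw.2) hM0))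
      (x := x) (y := z) ⟨hx, by simpa using hr0⟩ hz
    have e : H₁ z - H₁ x - H₂ x (z - x) = H₁ z - H₂ x z - (H₁ x - H₂ x x) := by
      rw [map_sub]
      abel
    rw [e]
    refine this.trans ?_
    have := mul_le_mul_of_nonneg_left hzx (mul_nonneg hM0 hr0)
    linarith
  have hpath : ∀ t ∈ Set.Icc (0 : ℝ) 1, HasDerivWithinAt
      (fun t : ℝ => u (y + t • v) - t • (H₁ x v + H₂ x (y - x) v) - (t ^ 2 / 2) • H₂ x v v)
      ((H₁ (y + t • v) - H₁ x - H₂ x (y + t • v - x)) v) (Set.Icc 0 1) t := by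
    intro t _
    have hl : HasDerivAt (fun t : ℝ => y + t • v) v t := by
      simpa using ((hasDerivAt_id t).smul_const v).const_add y
    have d1 : HasDerivAt (fun t : ℝ => u (y + t • v)) (H₁ (y + t • v) v) t :=
      (h₁ _).comp_hasDerivAt t hl
    have d2 : HasDerivAt (fun t : ℝ => t • (H₁ x v + H₂ x (y - x) v))
        ((1 : ℝ) • (H₁ x v + H₂ x (y - x) v)) t := (hasDerivAt_id t).smul_const _
    have d3 : HasDerivAt (fun t : ℝ => (t ^ 2 / 2) • H₂ x v v) (t • H₂ x v v) t := by
      have : HasDerivAt (fun t : ℝ => t ^ 2 / 2) t t := by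
        have := (hasDerivAt_pow 2 t).div_const 2
        simpa using this
      exact this.smul_const _
    refine (((d1.sub d2).sub d3).congr_deriv ?_).hasDerivWithinAt
    have e : y + t • v - x = (y - x) + t • v := by abel
    rw [e]
    simp only [map_add, map_smul, one_smul, sub_apply, add_apply, smul_apply]
    abel
  have h0 : (0 : ℝ) ∈ Set.Icc (0 : ℝ) 1 := by simp
  have h1 : (1 : ℝ) ∈ Set.Icc (0 : ℝ) 1 := by simp
  have := (convex_Icc (0 : ℝ) 1).norm_image_sub_le_of_norm_hasDerivWithin_le hpath
    (C := M * r ^ 2 * ‖v‖) (fun t ht => ?_) h0 h1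
  · simp only [one_smul, zero_smul, add_zero, sub_zero, norm_one, mul_one] at this
    convert this using 2
    norm_num
    abel
  · refine ContinuousLinearMap.le_of_opNorm_le _ (hrem _ ?_) v
    have := hC.add_smul_sub_mem hyC hyvC ht
    rwa [add_sub_cancel_left] at this

end Taylor

/-! ### Taylor expansion of functions in `Ẇ^{3,∞}` -/

section Displacement

variable {d : ℕ} {u : Space d → Space d}
    {G₁ : Space d → Space d →L[ℝ] Space d}
    {G₂ : Space d → Space d →L[ℝ] Space d →L[ℝ] Space d}
    {G₃ : Space d → Space d →L[ℝ] Space d →L[ℝ] Space d →L[ℝ] Space d}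

theorem IsHomSobolevThree.norm_fderiv_le (h : IsHomSobolevThree u G₁ G₂ G₃) {κ : ℝ} (hκ : 0 < κ)
    (hG₁ : eLpNorm G₁ ∞ volume ≤ ENNReal.ofReal κ) (x : Space d) :
    DifferentiableAt ℝ u x ∧ ‖fderiv ℝ u x‖ ≤ κ := by
  obtain ⟨H₁, H₂, hu, -, hc, -, he, -, -⟩ := h.exists_deriv
  refine ⟨(hu x).differentiableAt, ?_⟩
  rw [(hu x).fderiv]
  have h1 := enorm_le_supNormOn hc he (s := Set.univ) (y := x) (by simp)
  rw [supNormOn, Measure.restrict_univ] at h1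
  have h2 := h1.trans hG₁
  rw [← ofReal_norm] at h2
  exact (ENNReal.ofReal_le_ofReal_iff hκ.le).1 h2

theorem IsHomSobolevThree.norm_image_sub_le (h : IsHomSobolevThree u G₁ G₂ G₃) {κ : ℝ} (hκ : 0 < κ)
    (hG₁ : eLpNorm G₁ ∞ volume ≤ ENNReal.ofReal κ) (x y : Space d) :
    ‖u y - u x‖ ≤ κ * ‖y - x‖ :=
  convex_univ.norm_image_sub_le_of_norm_fderiv_le (𝕜 := ℝ)
    (fun z _ => (h.norm_fderiv_le hκ hG₁ z).1) (fun z _ => (h.norm_fderiv_le hκ hG₁ z).2)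
    trivial trivial

/-- Taylor expansions about `x` of the finite differences `u (y + w) - u y` at a point `y` close to
the segment from `x` to `x - v`. Only the derivatives of `u` in a neighbourhood of the
parallelogram at `x` spanned by `v` and `w` enter. -/
theorem IsHomSobolevThree.exists_taylor (h : IsHomSobolevThree u G₁ G₂ G₃) (x : Space d) :
    ∃ H : Space d →L[ℝ] Space d →L[ℝ] Space d, ∀ (R : ℝ) (v w y : Space d), 0 < R → 1 ≤ ‖v‖ →
      (∃ t ∈ Set.Icc (0 : ℝ) 1, ‖y + t • v - x‖ < R) →
      ‖u (y + w) - u y - fderiv ℝ u x w‖ ≤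
        (supNormOn G₂ (x +ᵥ parNhd (R + 1) v w)).toReal * ((R + 1) * (‖v‖ + ‖w‖)) * ‖w‖ ∧
      ‖u (y + w) - u y - fderiv ℝ u x w - H (y - x) w - (1 / 2 : ℝ) • H w w‖ ≤
        (supNormOn G₃ (x +ᵥ parNhd (R + 1) v w)).toReal * ((R + 1) * (‖v‖ + ‖w‖)) ^ 2 * ‖w‖ := by
  obtain ⟨H₁, H₂, hu, hu', -, hc, -, he, hw₃⟩ := h.exists_deriv
  refine ⟨H₂ x, ?_⟩
  rintro R v w y hR hv ⟨t, ht, hy⟩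
  set U : Set (Space d) := x +ᵥ parNhd R v w with hUdef
  have hU : Convex ℝ U := (convex_parNhd R v w).vadd x
  have hmem : ∀ z, z ∈ U ↔ z - x ∈ parNhd R v w := by
    intro z
    rw [hUdef, Set.mem_vadd_set_iff_neg_vadd_mem, vadd_eq_add, neg_add_eq_sub]
  have hmem' : ∀ z, z ∈ x +ᵥ parNhd (R + 1) v w ↔ z - x ∈ parNhd (R + 1) v w := by
    intro z
    rw [Set.mem_vadd_set_iff_neg_vadd_mem, vadd_eq_add, neg_add_eq_sub]
  have hopen : IsOpen (x +ᵥ parNhd (R + 1) v w) := (isOpen_parNhd _ v w).vadd x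
  have hxU : x ∈ U := by
    rw [hmem, sub_self]
    exact zero_mem_parNhd hR v w
  have htabs : |-t| ≤ 1 := by
    rw [abs_neg, abs_of_nonneg ht.1]
    exact ht.2
  have hyU : y ∈ U := by
    rw [hmem]
    refine ⟨-t, 0, htabs, by simp, ?_⟩
    convert hy using 2
    module
  have hywU : y + w ∈ U := by
    rw [hmem]
    refine ⟨-t, 1, htabs, by simp, ?_⟩
    convert hy using 2
    module
  have hr : ‖y - x‖ + ‖w‖ ≤ (R + 1) * (‖v‖ + ‖w‖) := by
    have h1 : ‖t • v‖ ≤ ‖v‖ := by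
      rw [norm_smul, Real.norm_eq_abs, abs_of_nonneg ht.1]
      exact mul_le_of_le_one_left (norm_nonneg _) ht.2
    have e : y - x = (y + t • v - x) - t • v := by abel
    have h2 : ‖y - x‖ ≤ R + ‖v‖ := by
      rw [e]
      exact (norm_sub_le _ _).trans (by linarith)
    nlinarith [norm_nonneg w]
  have hN : ∀ z ∈ U, ‖H₂ z‖ ≤ (supNormOn G₂ (x +ᵥ parNhd (R + 1) v w)).toReal := by
    intro z hz
    rw [← toReal_enorm]
    refine ENNReal.toReal_mono (h.bdd₂.restrict _).2.ne (enorm_le_supNormOn hc he ?_)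
    rw [hopen.interior_eq, hmem']
    exact parNhd_mono (by linarith) v w ((hmem z).1 hz)
  have hthick : Metric.thickening 1 U ⊆ x +ᵥ parNhd (R + 1) v w := by
    intro z hz
    obtain ⟨z', hz', hzz⟩ := Metric.mem_thickening_iff.1 hz
    rw [hmem']
    apply thickening_parNhd_subset R 1 v w
    exact Metric.mem_thickening_iff.2 ⟨z' - x, (hmem z').1 hz', by simpa using hzz⟩
  have hM : ∀ z ∈ U, ‖H₂ z - H₂ x‖ ≤
      (supNormOn G₃ (x +ᵥ parNhd (R + 1) v w)).toReal * ‖z - x‖ := fun z hz =>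
    hw₃.norm_sub_le_of_continuous hc hU one_pos
      (ae_norm_le_supNormOn h.bdd₃ Metric.isOpen_thickening hthick) hxU hz
  rw [(hu x).fderiv]
  exact ⟨norm_sub_sub_le_of_deriv_two hu hu' hU hN hxU hyU hywU hr,
    norm_sub_sub_sub_le_of_lipschitz hu hu' hU ENNReal.toReal_nonneg hM hxU hyU hywU hr⟩

end Displacement

/-! ### Comparison of the two stresses -/

section Comparison

open Stencil

variable {d : ℕ} {V : Stencil d → EReal} {κ : ℝ} {k : ℕ} {ζ : Space d → ℝ}

theorem msBound_top {n : ℕ} (hn : n ≠ 0) (ρ : Fin (n + 1) → Dir d) :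
    msBound V κ ∞ ρ = mBound V κ ρ * (∑ i, ‖(ρ i).vec‖ₑ) ^ 2 := by
  have h : (n : ℝ≥0∞) * ∞ = ∞ := ENNReal.mul_top (by exact_mod_cast hn)
  rw [msBound, h]
  simp

theorem msBound_top_eq_ofReal (hV : IsSiteEnergy V κ k) {n : ℕ} (hn : n ≠ 0) (hnk : n + 1 ≤ k)
    (ρ : Fin (n + 1) → Dir d) : msBound V κ ∞ ρ =
      ENNReal.ofReal (derivSup V κ ρ * (∏ i, ‖(ρ i).vec‖) * (∑ i, ‖(ρ i).vec‖) ^ 2) := by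
  have h0 := derivSup_nonneg (V := V) (κ := κ) ρ
  have h1 : 0 ≤ ∏ i, ‖(ρ i).vec‖ := Finset.prod_nonneg fun i _ => norm_nonneg _
  have h2 : 0 ≤ ∑ i, ‖(ρ i).vec‖ := Finset.sum_nonneg fun i _ => norm_nonneg _
  rw [msBound_top hn, mBound_eq hV (by omega) hnk, ENNReal.ofReal_mul (mul_nonneg h0 h1),
    ENNReal.ofReal_pow h2, ENNReal.ofReal_sum_of_nonneg fun i _ => norm_nonneg _]
  simp only [ofReal_norm]

theorem abs_apply_le_norm (v : Space d) (α : Fin d) : |v α| ≤ ‖v‖ := PiLp.norm_apply_le v α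

theorem norm_unitVec (i : Fin d) : ‖(unitVec i : Space d)‖ = 1 := by simp [unitVec]

theorem entry_diffStencil {v : Site d → Space d}
    (hv : ∀ ξ (ρ : Dir d), ‖v (ξ + ρ.1) - v ξ‖ ≤ κ * ‖ρ.vec‖) (ξ : Site d) (ρ : Dir d) :
    entry (diffStencil v ξ) ρ = v (ξ + ρ.1) - v ξ :=
  entry_ofFun _ κ (fun σ => hv ξ σ) ρ

theorem diffStencil_mem (hκ : 0 < κ) {v : Site d → Space d}
    (hv : ∀ ξ (ρ : Dir d), ‖v (ξ + ρ.1) - v ξ‖ ≤ κ * ‖ρ.vec‖) (ξ : Site d) :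
    diffStencil v ξ ∈ stencilBall d κ := by
  rw [mem_stencilBall_iff hκ.le]
  intro ρ
  rw [entry_diffStencil hv]
  exact hv ξ ρ

/-! ### Summation against the weights -/

theorem hasSum_chi (hζ : IsNodalBasis ζ) (ρ : Dir d) (x : Space d) :
    HasSum (fun ξ => chi ζ ξ ρ x) 1 := by
  obtain ⟨s, hs0, hs1, -⟩ := hζ.exists_finset_chi ρ x
  rw [← hs1]
  exact hasSum_sum_of_ne_finset_zero hs0

theorem summable_mul_chi (hζ : IsNodalBasis ζ) (x : Space d) {c : Dir d → ℝ} (hc : Summable c)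
    (hc0 : ∀ ρ, 0 ≤ c ρ) : Summable fun q : Dir d × Site d => c q.1 * chi ζ q.2 q.1 x := by
  rw [summable_prod_of_nonneg fun q => mul_nonneg (hc0 _) (chi_nonneg hζ _ _ _)]
  refine ⟨fun ρ => (hasSum_chi hζ ρ x).summable.mul_left (c ρ), hc.congr fun ρ => ?_⟩
  simp only []
  rw [tsum_mul_left, (hasSum_chi hζ ρ x).tsum_eq, mul_one]

theorem atomStressTerm_eq (u : Space d → Space d) (x : Space d) (i α : Fin d)
    (q : Site d × Dir d) :
    atomStressTerm ζ V κ u x i α q =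
      q.2.vec α * (chi ζ q.1 q.2 x *
        partialDeriv V κ ![q.2] (diffStencil (onLattice u) q.1) ![unitVec i]) := by
  unfold atomStressTerm
  have h1 : (fun _ : Fin 1 => q.2) = ![q.2] := by
    funext j
    simp
  have h2 : (fun _ : Fin 1 => (unitVec i : Space d)) = ![unitVec i] := by
    funext j
    simp
  rw [h1, h2]
  ring

theorem summable_atomStressTerm (hζ : IsNodalBasis ζ) (hκ : 0 < κ) (hV : IsSiteEnergy V κ k)
    (hk : 3 ≤ k) {u : Space d → Space d}
    (hu : ∀ ξ (ρ : Dir d), ‖onLattice u (ξ + ρ.1) - onLattice u ξ‖ ≤ κ * ‖ρ.vec‖)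
    (x : Space d) (i α : Fin d) : Summable (atomStressTerm ζ V κ u x i α) := by
  rw [← (Equiv.prodComm (Dir d) (Site d)).summable_iff]
  refine Summable.of_norm_bounded (summable_mul_chi hζ x (summable_derivSup_one hV hk)
    fun ρ => mul_nonneg (derivSup_nonneg _) (norm_nonneg _)) fun q => ?_
  simp only [Function.comp, Equiv.prodComm_apply, Prod.fst_swap, Prod.snd_swap, atomStressTerm_eq,
    Real.norm_eq_abs, abs_mul, abs_of_nonneg (chi_nonneg hζ _ _ _)]
  have h1 := abs_apply_le_norm q.1.vec α
  have h2 := abs_partialDeriv_le hV le_rfl (by omega) ![q.1] (diffStencil_mem hκ hu q.2)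
    ![unitVec i]
  simp only [Finset.univ_unique, Fin.default_eq_zero, Finset.prod_singleton,
    Matrix.cons_val_zero, norm_unitVec, mul_one] at h2
  have h3 := chi_nonneg hζ q.2 q.1 x
  calc _ ≤ ‖q.1.vec‖ * (chi ζ q.2 q.1 x * derivSup V κ ![q.1]) := by gcongr
    _ = _ := by ring

/-! ### The second derivative at a homogeneous stencil -/

/-- The linear form `a ↦ V_{ρσ}(F · Λ_*)[e, a]`. -/
noncomputable def hessForm (V : Stencil d → EReal) (κ : ℝ) (F : Space d →L[ℝ] Space d)
    (e : Space d) (ρ σ : Dir d) : Space d →L[ℝ] ℝ :=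
  (partialDeriv V κ ![ρ, σ] (homStencil F)).toContinuousLinearMap ![e, 0] 1

theorem hessForm_apply (F : Space d →L[ℝ] Space d) (e a : Space d) (ρ σ : Dir d) :
    hessForm V κ F e ρ σ a = partialDeriv V κ ![ρ, σ] (homStencil F) ![e, a] := by
  change partialDeriv V κ ![ρ, σ] (homStencil F) (Function.update ![e, 0] 1 a) = _
  congr 1
  funext j
  fin_cases j <;> simp

theorem abs_hessForm_le (hκ : 0 < κ) (hV : IsSiteEnergy V κ k) (hk : 3 ≤ k)
    {F : Space d →L[ℝ] Space d} (hF : F ∈ gradBall d κ) {e : Space d} (he : ‖e‖ = 1)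
    (ρ σ : Dir d) (a : Space d) :
    |hessForm V κ F e ρ σ a| ≤ derivSup V κ ![ρ, σ] * ‖a‖ := by
  rw [hessForm_apply]
  have := abs_partialDeriv_le hV (by norm_num) (by omega) ![ρ, σ] (homStencil_mem hF hκ) ![e, a]
  simpa [Fin.prod_univ_two, he] using this

theorem hessForm_opp (hκ : 0 < κ) (hV : IsSiteEnergy V κ k) (hk : 3 ≤ k)
    {F : Space d →L[ℝ] Space d} (hF : F ∈ gradBall d κ) (e : Space d) (ρ σ : Dir d) :
    hessForm V κ F e (Dir.opp ρ) (Dir.opp σ) = hessForm V κ F e ρ σ := by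
  ext a
  rw [hessForm_apply, hessForm_apply, partialDeriv_two_opp hκ hV hk hF]

/-- The involution `(ρ, σ) ↦ (-ρ, -σ)`. -/
def oppPair (d : ℕ) : Dir d × Dir d ≃ Dir d × Dir d where
  toFun q := (Dir.opp q.1, Dir.opp q.2)
  invFun q := (Dir.opp q.1, Dir.opp q.2)
  left_inv q := by simp [opp_opp]
  right_inv q := by simp [opp_opp]

/-- The linear terms for `(ρ, σ)` and `(-ρ, -σ)` cancel up to third derivatives of `u`. -/
theorem abs_hessForm_add_opp_le (hκ : 0 < κ) (hV : IsSiteEnergy V κ k) (hk : 3 ≤ k)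
    {F : Space d →L[ℝ] Space d} (hF : F ∈ gradBall d κ) {e : Space d} (he : ‖e‖ = 1) (α : Fin d)
    {η : Dir d → Dir d → Space d} {A : ℝ} {M : Dir d → Dir d → ℝ}
    {H : Space d →L[ℝ] Space d →L[ℝ] Space d}
    (hη : ∀ ρ σ, ‖η ρ σ - (1 / 2 : ℝ) • H (σ.vec - ρ.vec) σ.vec‖ ≤
      M ρ σ * (A * (‖ρ.vec‖ + ‖σ.vec‖)) ^ 2 * ‖σ.vec‖)
    (hM : ∀ ρ σ, M (Dir.opp ρ) (Dir.opp σ) = M ρ σ) (ρ σ : Dir d) :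
    |(1 / 2 : ℝ) * (ρ.vec α * hessForm V κ F e ρ σ (η ρ σ) + (Dir.opp ρ).vec α *
      hessForm V κ F e (Dir.opp ρ) (Dir.opp σ) (η (Dir.opp ρ) (Dir.opp σ)))| ≤
      A ^ 2 * (derivSup V κ ![ρ, σ] * (‖ρ.vec‖ * ‖σ.vec‖) *
        (‖ρ.vec‖ + ‖σ.vec‖) ^ 2 * M ρ σ) := by
  set D := η ρ σ - η (Dir.opp ρ) (Dir.opp σ) with hD
  have hDb : ‖D‖ ≤ 2 * (M ρ σ * (A * (‖ρ.vec‖ + ‖σ.vec‖)) ^ 2 * ‖σ.vec‖) := by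
    have h1 := hη ρ σ
    have h2 := hη (Dir.opp ρ) (Dir.opp σ)
    rw [hM, vec_opp, vec_opp, norm_neg, norm_neg] at h2
    have e2 : H (-σ.vec - -ρ.vec) (-σ.vec) = H (σ.vec - ρ.vec) σ.vec := by
      rw [← neg_sub', map_neg]
      simp
    rw [e2] at h2
    have e3 : D = (η ρ σ - (1 / 2 : ℝ) • H (σ.vec - ρ.vec) σ.vec) -
        (η (Dir.opp ρ) (Dir.opp σ) - (1 / 2 : ℝ) • H (σ.vec - ρ.vec) σ.vec) := by
      rw [hD]; abel
    rw [e3]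
    refine (norm_sub_le _ _).trans ?_
    linarith
  have e4 : ρ.vec α * hessForm V κ F e ρ σ (η ρ σ) + (Dir.opp ρ).vec α *
      hessForm V κ F e (Dir.opp ρ) (Dir.opp σ) (η (Dir.opp ρ) (Dir.opp σ)) =
      ρ.vec α * hessForm V κ F e ρ σ D := by
    rw [hessForm_opp hκ hV hk hF, vec_opp, hD, map_sub, PiLp.neg_apply]
    ring
  rw [e4, abs_mul, abs_mul]
  have h3 := abs_hessForm_le hκ hV hk hF he ρ σ D
  have h4 := abs_apply_le_norm ρ.vec α
  have h5 := derivSup_nonneg (V := V) (κ := κ) ![ρ, σ]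
  calc _ ≤ |(1 / 2 : ℝ)| * (‖ρ.vec‖ * (derivSup V κ ![ρ, σ] *
        (2 * (M ρ σ * (A * (‖ρ.vec‖ + ‖σ.vec‖)) ^ 2 * ‖σ.vec‖)))) := by
        gcongr
        exact h3.trans (mul_le_mul_of_nonneg_left hDb h5)
    _ = _ := by
        rw [abs_of_pos (by norm_num)]
        ring

/-- Summation over the pairs `(ρ, σ)` and `(-ρ, -σ)` together. -/
theorem enorm_tsum_le_of_oppPair {T : Dir d × Dir d → ℝ} (hsum : Summable T)
    {Y : Dir d × Dir d → ℝ≥0∞}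
    (hY : ∀ q, ‖(1 / 2 : ℝ) * (T q + T (oppPair d q))‖ₑ ≤ Y q) : ‖∑' q, T q‖ₑ ≤ ∑' q, Y q := by
  have hsum' : Summable fun q => T (oppPair d q) := (oppPair d).summable_iff.2 hsum
  have hsymm : ∑' q, T q = ∑' q, (1 / 2 : ℝ) * (T q + T (oppPair d q)) := by
    rw [tsum_mul_left, hsum.tsum_add hsum', (oppPair d).tsum_eq T]
    ring
  rw [hsymm]
  exact enorm_tsum_le_tsum_enorm.trans (ENNReal.tsum_le_tsum hY)

theorem msBound_two (hV : IsSiteEnergy V κ k) (hk : 3 ≤ k) (ρ σ : Dir d) :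
    msBound V κ ∞ ![ρ, σ] = ENNReal.ofReal (derivSup V κ ![ρ, σ] *
      (‖ρ.vec‖ * ‖σ.vec‖) * (‖ρ.vec‖ + ‖σ.vec‖) ^ 2) := by
  rw [msBound_top_eq_ofReal hV (by norm_num) (by omega), Fin.prod_univ_two, Fin.sum_univ_two]
  rfl

/-- The sum of the linear terms of the expansion is of second order: the contributions of
`(ρ, σ)` and `(-ρ, -σ)`, in which the second derivatives of `u` enter through an odd cubic
expression in `(ρ, σ)`, are paired before summation, since the separate sums of these contributions
need not converge. -/
theorem enorm_tsum_hessForm_le (hκ : 0 < κ) (hV : IsSiteEnergy V κ k) (hk : 3 ≤ k)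
    {F : Space d →L[ℝ] Space d} (hF : F ∈ gradBall d κ) {e : Space d} (he : ‖e‖ = 1) (α : Fin d)
    {η : Dir d → Dir d → Space d} {A : ℝ} {M : Dir d → Dir d → ℝ}
    {H : Space d →L[ℝ] Space d →L[ℝ] Space d}
    (hη : ∀ ρ σ, ‖η ρ σ - (1 / 2 : ℝ) • H (σ.vec - ρ.vec) σ.vec‖ ≤
      M ρ σ * (A * (‖ρ.vec‖ + ‖σ.vec‖)) ^ 2 * ‖σ.vec‖)
    (hM : ∀ ρ σ, M (Dir.opp ρ) (Dir.opp σ) = M ρ σ)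
    (hsum : Summable fun q : Dir d × Dir d => q.1.vec α * hessForm V κ F e q.1 q.2 (η q.1 q.2)) :
    ‖∑' q : Dir d × Dir d, q.1.vec α * hessForm V κ F e q.1 q.2 (η q.1 q.2)‖ₑ ≤
      ENNReal.ofReal (A ^ 2) *
        ∑' ρ : Fin 2 → Dir d, msBound V κ ∞ ρ * ENNReal.ofReal (M (ρ 0) (ρ 1)) := by
  rw [← ENNReal.tsum_mul_left, ← (finTwoArrowEquiv (Dir d)).symm.tsum_eq]
  refine enorm_tsum_le_of_oppPair hsum fun q => ?_
  change _ ≤ ENNReal.ofReal (A ^ 2) * (msBound V κ ∞ ![q.1, q.2] * ENNReal.ofReal (M q.1 q.2))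
  have h5 := derivSup_nonneg (V := V) (κ := κ) ![q.1, q.2]
  rw [msBound_two hV hk, ← ENNReal.ofReal_mul (by positivity), ← ENNReal.ofReal_mul (sq_nonneg A),
    ← ofReal_norm]
  exact ENNReal.ofReal_le_ofReal (abs_hessForm_add_opp_le hκ hV hk hF he α hη hM q.1 q.2)

/-! ### Estimate of the components -/

variable {F : Space d →L[ℝ] Space d} {u : Space d → Space d} {x : Space d} {A : ℝ}
  {M N : Dir d → Dir d → ℝ} {H : Space d →L[ℝ] Space d →L[ℝ] Space d}

theorem enorm_sum_mul_le {ι : Type*} (s : Finset ι) {c r : ι → ℝ} (hc : ∀ i ∈ s, 0 ≤ c i)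
    (hc1 : ∑ i ∈ s, c i = 1) {Y : ℝ≥0∞} (hr : ∀ i ∈ s, c i ≠ 0 → ‖r i‖ₑ ≤ Y) :
    ‖∑ i ∈ s, c i * r i‖ₑ ≤ Y := by
  calc _ ≤ ∑ i ∈ s, ‖c i * r i‖ₑ := enorm_sum_le _ _
    _ ≤ ∑ i ∈ s, ENNReal.ofReal (c i) * Y := by
        refine Finset.sum_le_sum fun i hi => ?_
        rw [enorm_mul, Real.enorm_eq_ofReal (hc i hi)]
        by_cases h : c i = 0
        · simp [h]
        · gcongr
          exact hr i hi h
    _ = Y := by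
        rw [← Finset.sum_mul, ← ENNReal.ofReal_sum_of_nonneg hc, hc1, ENNReal.ofReal_one, one_mul]

/-- The remainder of the linearisation of `V_ρ` about the homogeneous stencil. -/
theorem enorm_remainder_le (hκ : 0 < κ) (hV : IsSiteEnergy V κ k) (hk : 3 ≤ k)
    (hF : F ∈ gradBall d κ) {e : Space d} (he : ‖e‖ = 1) (hA : 0 ≤ A)
    (hN0 : ∀ ρ σ, 0 ≤ N ρ σ) {g : Stencil d} (hg : g ∈ stencilBall d κ) (ρ : Dir d)
    (hN : ∀ σ, ‖entry (g - homStencil F) σ‖ ≤ N ρ σ * (A * (‖ρ.vec‖ + ‖σ.vec‖)) * ‖σ.vec‖) :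
    ‖partialDeriv V κ ![ρ] g ![e] - partialDeriv V κ ![ρ] (homStencil F) ![e] -
      ∑' σ, hessForm V κ F e ρ σ (entry (g - homStencil F) σ)‖ₑ ≤
      ∑' q : Dir d × Dir d, ENNReal.ofReal (A ^ 2 * (derivSup V κ ![ρ, q.1, q.2] *
        (‖q.1.vec‖ * ‖q.2.vec‖) * (‖ρ.vec‖ + ‖q.1.vec‖ + ‖q.2.vec‖) ^ 2 *
          (N ρ q.1 * N ρ q.2))) := by
  have h := abs_partialDeriv_sub_le hκ hV hk ρ he.le hg (homStencil_mem hF hκ)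
  simp_rw [← hessForm_apply] at h
  rw [← Real.norm_eq_abs] at h
  rw [← ofReal_norm]
  refine (ENNReal.ofReal_le_ofReal (h.trans (le_abs_self _))).trans ?_
  rw [← Real.norm_eq_abs, ofReal_norm]
  refine enorm_tsum_le_tsum_enorm.trans (ENNReal.tsum_le_tsum fun q => ?_)
  have h0 := derivSup_nonneg (V := V) (κ := κ) ![ρ, q.1, q.2]
  rw [Real.enorm_eq_ofReal (by positivity)]
  apply ENNReal.ofReal_le_ofReal
  have hN1 := hN0 ρ q.1
  have hN2 := hN0 ρ q.2
  have hmono : ∀ {n a b : ℝ} {c : Space d}, 0 ≤ n → a ≤ b → n * (A * a) * ‖c‖ ≤ n * (A * b) * ‖c‖ :=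
    fun hn hab => mul_le_mul_of_nonneg_right
      (mul_le_mul_of_nonneg_left (mul_le_mul_of_nonneg_left hab hA) hn) (norm_nonneg _)
  calc _ ≤ derivSup V κ ![ρ, q.1, q.2] *
        (N ρ q.1 * (A * (‖ρ.vec‖ + ‖q.1.vec‖ + ‖q.2.vec‖)) * ‖q.1.vec‖) *
        (N ρ q.2 * (A * (‖ρ.vec‖ + ‖q.1.vec‖ + ‖q.2.vec‖)) * ‖q.2.vec‖) := by
        gcongr
        · exact (hN q.1).trans (hmono hN1 (by linarith [norm_nonneg q.2.vec]))
        · exact (hN q.2).trans (hmono hN2 (by linarith [norm_nonneg q.1.vec]))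
    _ = _ := by ring

/-- The bijection between triples `(ρ, σ, τ)` and families indexed by `Fin 3`. -/
def tripleEquiv (d : ℕ) : Dir d × Dir d × Dir d ≃ (Fin 3 → Dir d) where
  toFun q := ![q.1, q.2.1, q.2.2]
  invFun ρ := (ρ 0, ρ 1, ρ 2)
  left_inv _ := rfl
  right_inv ρ := by
    funext j
    fin_cases j <;> rfl

theorem msBound_three (hV : IsSiteEnergy V κ k) (hk : 3 ≤ k) (ρ σ τ : Dir d) :
    msBound V κ ∞ ![ρ, σ, τ] = ENNReal.ofReal (derivSup V κ ![ρ, σ, τ] *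
      (‖ρ.vec‖ * ‖σ.vec‖ * ‖τ.vec‖) * (‖ρ.vec‖ + ‖σ.vec‖ + ‖τ.vec‖) ^ 2) := by
  rw [msBound_top_eq_ofReal hV (by norm_num) (by omega), Fin.prod_univ_three, Fin.sum_univ_three]
  rfl

theorem enorm_tsum_mul_le_msBound_three (hV : IsSiteEnergy V κ k) (hk : 3 ≤ k)
    (hN0 : ∀ ρ σ, 0 ≤ N ρ σ) {r : Dir d → ℝ} {α : Fin d}
    (hr : ∀ ρ, ‖r ρ‖ₑ ≤
      ∑' q : Dir d × Dir d, ENNReal.ofReal (A ^ 2 * (derivSup V κ ![ρ, q.1, q.2] *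
        (‖q.1.vec‖ * ‖q.2.vec‖) * (‖ρ.vec‖ + ‖q.1.vec‖ + ‖q.2.vec‖) ^ 2 *
          (N ρ q.1 * N ρ q.2)))) :
    ‖∑' ρ : Dir d, ρ.vec α * r ρ‖ₑ ≤ ENNReal.ofReal (A ^ 2) * ∑' ρ : Fin 3 → Dir d,
      msBound V κ ∞ ρ * ENNReal.ofReal (N (ρ 0) (ρ 1)) * ENNReal.ofReal (N (ρ 0) (ρ 2)) := by
  refine enorm_tsum_le_tsum_enorm.trans ?_
  rw [← ENNReal.tsum_mul_left, ← (tripleEquiv d).tsum_eq, ENNReal.tsum_prod']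
  refine ENNReal.tsum_le_tsum fun ρ => ?_
  rw [enorm_mul]
  have hα : ‖ρ.vec α‖ₑ ≤ ENNReal.ofReal ‖ρ.vec‖ := by
    rw [← ofReal_norm]
    exact ENNReal.ofReal_le_ofReal (PiLp.norm_apply_le ρ.vec α)
  refine (mul_le_mul' hα (hr ρ)).trans ?_
  rw [← ENNReal.tsum_mul_left]
  refine ENNReal.tsum_le_tsum fun q => le_of_eq ?_
  change _ = ENNReal.ofReal (A ^ 2) * (msBound V κ ∞ ![ρ, q.1, q.2] *
    ENNReal.ofReal (N ρ q.1) * ENNReal.ofReal (N ρ q.2))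
  have h5 := derivSup_nonneg (V := V) (κ := κ) ![ρ, q.1, q.2]
  have h6 : 0 ≤ derivSup V κ ![ρ, q.1, q.2] * (‖ρ.vec‖ * ‖q.1.vec‖ * ‖q.2.vec‖) *
      (‖ρ.vec‖ + ‖q.1.vec‖ + ‖q.2.vec‖) ^ 2 := by positivity
  rw [msBound_three hV hk, ← ENNReal.ofReal_mul (norm_nonneg _), ← ENNReal.ofReal_mul h6,
    ← ENNReal.ofReal_mul (mul_nonneg h6 (hN0 ρ q.1)), ← ENNReal.ofReal_mul (sq_nonneg A)]
  congr 1
  ring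

/-- Second-order estimate for the components of the stress difference. The form `H` stands for
`∇²u(x)`, and `N ρ σ` and `M ρ σ` for the bounds of `∇²u` and `∇³u` near the parallelogram spanned by
`ρ` and `σ` at `x`. -/
theorem enorm_stress_component_sub_le (hζ : IsNodalBasis ζ) (hκ : 0 < κ)
    (hV : IsSiteEnergy V κ k) (hk : 3 ≤ k) (hF : F ∈ gradBall d κ)
    (hu : ∀ ξ (ρ : Dir d), ‖onLattice u (ξ + ρ.1) - onLattice u ξ‖ ≤ κ * ‖ρ.vec‖)
    (hA : 0 ≤ A) (hN0 : ∀ ρ σ, 0 ≤ N ρ σ)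
    (hN : ∀ ξ ρ (σ : Dir d), chi ζ ξ ρ x ≠ 0 →
      ‖onLattice u (ξ + σ.1) - onLattice u ξ - F σ.vec‖ ≤
        N ρ σ * (A * (‖ρ.vec‖ + ‖σ.vec‖)) * ‖σ.vec‖)
    (hM : ∀ ξ ρ (σ : Dir d), chi ζ ξ ρ x ≠ 0 →
      ‖onLattice u (ξ + σ.1) - onLattice u ξ - F σ.vec - H (Site.pt ξ - x) σ.vec -
        (1 / 2 : ℝ) • H σ.vec σ.vec‖ ≤ M ρ σ * (A * (‖ρ.vec‖ + ‖σ.vec‖)) ^ 2 * ‖σ.vec‖)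
    (hMopp : ∀ ρ σ, M (Dir.opp ρ) (Dir.opp σ) = M ρ σ) (i α : Fin d) :
    ‖∑' q, atomStressTerm ζ V κ u x i α q -
      ∑' ρ : Dir d, partialDeriv V κ ![ρ] (homStencil F) ![unitMat i α ρ.vec]‖ₑ ≤
      ENNReal.ofReal (A ^ 2) *
        ((∑' ρ : Fin 2 → Dir d, msBound V κ ∞ ρ * ENNReal.ofReal (M (ρ 0) (ρ 1))) +
          ∑' ρ : Fin 3 → Dir d, msBound V κ ∞ ρ * ENNReal.ofReal (N (ρ 0) (ρ 1)) *
            ENNReal.ofReal (N (ρ 0) (ρ 2))) := by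
  set e : Space d := unitVec i with he_def
  have he : ‖e‖ = 1 := norm_unitVec i
  have hmem := homStencil_mem hF hκ
  choose s hs0 hs1 hs2 using fun ρ => hζ.exists_finset_chi ρ x
  set g : Site d → Stencil d := diffStencil (onLattice u) with hg_def
  have hg : ∀ ξ, g ξ ∈ stencilBall d κ := diffStencil_mem hκ hu
  set δ : Site d → Dir d → Space d := fun ξ σ => entry (g ξ - homStencil F) σ with hδ_def
  have hδ : ∀ ξ σ, δ ξ σ = onLattice u (ξ + σ.1) - onLattice u ξ - F σ.vec := fun ξ σ => by
    simp only [hδ_def, entry_sub, entry_homStencil, hg_def, entry_diffStencil hu]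
  have hδb : ∀ ξ σ, ‖δ ξ σ‖ ≤ 2 * κ * ‖σ.vec‖ := by
    intro ξ σ
    simp only [hδ_def, entry_sub]
    have h1 := (mem_stencilBall_iff hκ.le).1 (hg ξ) σ
    have h2 := (mem_stencilBall_iff hκ.le).1 hmem σ
    exact (norm_sub_le _ _).trans (by linarith)
  set η : Dir d → Dir d → Space d := fun ρ σ => ∑ ξ ∈ s ρ, chi ζ ξ ρ x • δ ξ σ with hη_def
  have hηb : ∀ ρ σ, ‖η ρ σ‖ ≤ 2 * κ * ‖σ.vec‖ := by
    intro ρ σ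
    refine (norm_sum_le _ _).trans ?_
    calc _ ≤ ∑ ξ ∈ s ρ, chi ζ ξ ρ x * (2 * κ * ‖σ.vec‖) := by
          refine Finset.sum_le_sum fun ξ _ => ?_
          rw [norm_smul, Real.norm_eq_abs, abs_of_nonneg (chi_nonneg hζ _ _ _)]
          exact mul_le_mul_of_nonneg_left (hδb ξ σ) (chi_nonneg hζ _ _ _)
      _ = _ := by rw [← Finset.sum_mul, hs1, one_mul]
  -- the linear terms
  have hTsum : Summable fun q : Dir d × Dir d =>
      q.1.vec α * hessForm V κ F e q.1 q.2 (η q.1 q.2) := by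
    refine Summable.of_norm_bounded ((summable_derivSup_two hV hk).mul_right (2 * κ)) fun q => ?_
    rw [Real.norm_eq_abs, abs_mul]
    have h0 := derivSup_nonneg (V := V) (κ := κ) ![q.1, q.2]
    have h1 := abs_apply_le_norm q.1.vec α
    have h2 := (abs_hessForm_le hκ hV hk hF he q.1 q.2 (η q.1 q.2)).trans
      (mul_le_mul_of_nonneg_left (hηb q.1 q.2) h0)
    calc _ ≤ ‖q.1.vec‖ * (derivSup V κ ![q.1, q.2] * (2 * κ * ‖q.2.vec‖)) := by gcongr
      _ = _ := by ring
  have hηH : ∀ ρ σ, ‖η ρ σ - (1 / 2 : ℝ) • H (σ.vec - ρ.vec) σ.vec‖ ≤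
      M ρ σ * (A * (‖ρ.vec‖ + ‖σ.vec‖)) ^ 2 * ‖σ.vec‖ := by
    intro ρ σ
    set B := M ρ σ * (A * (‖ρ.vec‖ + ‖σ.vec‖)) ^ 2 * ‖σ.vec‖ with hB
    have e1 : η ρ σ - (1 / 2 : ℝ) • H (σ.vec - ρ.vec) σ.vec =
        ∑ ξ ∈ s ρ, chi ζ ξ ρ x •
          (δ ξ σ - H (Site.pt ξ - x) σ.vec - (1 / 2 : ℝ) • H σ.vec σ.vec) := by
      have h1 : ∑ ξ ∈ s ρ, chi ζ ξ ρ x • H (Site.pt ξ - x) σ.vec =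
          -(1 / 2 : ℝ) • H ρ.vec σ.vec := by
        have := congrArg (fun w => H w σ.vec) (hs2 ρ)
        simpa [map_sum, map_smul, sum_apply] using this
      simp only [smul_sub, Finset.sum_sub_distrib]
      rw [h1, ← Finset.sum_smul, hs1, map_sub, sub_apply]
      simp only [hη_def]
      module
    rw [e1]
    refine (norm_sum_le _ _).trans ?_
    calc _ ≤ ∑ ξ ∈ s ρ, chi ζ ξ ρ x * B := by
          refine Finset.sum_le_sum fun ξ _ => ?_
          rw [norm_smul, Real.norm_eq_abs, abs_of_nonneg (chi_nonneg hζ _ _ _)]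
          by_cases h0 : chi ζ ξ ρ x = 0
          · simp [h0]
          · refine mul_le_mul_of_nonneg_left ?_ (chi_nonneg hζ _ _ _)
            rw [hδ]
            exact hM ξ ρ σ h0
      _ = B := by rw [← Finset.sum_mul, hs1, one_mul]
  have hlin := enorm_tsum_hessForm_le hκ hV hk hF he α hηH hMopp hTsum
  -- the two stresses as sums over the directions
  have hat : Summable fun q : Dir d × Site d => atomStressTerm ζ V κ u x i α (q.2, q.1) :=
    (Equiv.prodComm (Dir d) (Site d)).summable_iff.2 (summable_atomStressTerm hζ hκ hV hk hu x i α)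
  have hinner : ∀ ρ : Dir d, ∑' ξ, atomStressTerm ζ V κ u x i α (ξ, ρ) =
      ρ.vec α * ∑ ξ ∈ s ρ, chi ζ ξ ρ x * partialDeriv V κ ![ρ] (g ξ) ![e] := by
    intro ρ
    simp only [atomStressTerm_eq]
    rw [tsum_mul_left, tsum_eq_sum (s := s ρ) fun ξ hξ => by rw [hs0 ρ ξ hξ, zero_mul]]
  have hatom : ∑' q, atomStressTerm ζ V κ u x i α q =
      ∑' ρ : Dir d, ρ.vec α * ∑ ξ ∈ s ρ, chi ζ ξ ρ x * partialDeriv V κ ![ρ] (g ξ) ![e] := by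
    rw [← (Equiv.prodComm (Dir d) (Site d)).tsum_eq]
    have := hat.tsum_prod
    simp only [hinner] at this
    exact this
  have hatomS : Summable fun ρ : Dir d =>
      ρ.vec α * ∑ ξ ∈ s ρ, chi ζ ξ ρ x * partialDeriv V κ ![ρ] (g ξ) ![e] := by
    have := hat.prod
    simpa only [hinner] using this
  have hunit : ∀ ρ : Dir d, partialDeriv V κ ![ρ] (homStencil F) ![unitMat i α ρ.vec] =
      ρ.vec α * partialDeriv V κ ![ρ] (homStencil F) ![e] := by
    intro ρ
    rw [partialDeriv_one hκ _ hmem, partialDeriv_one hκ _ hmem]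
    simp [derivAlong, unitMat, he_def]
  have hcbS : Summable fun ρ : Dir d => ρ.vec α * partialDeriv V κ ![ρ] (homStencil F) ![e] := by
    refine Summable.of_norm_bounded (summable_derivSup_one hV hk) fun ρ => ?_
    have h1 := abs_apply_le_norm ρ.vec α
    have h2 := abs_partialDeriv_le hV le_rfl (by omega) ![ρ] hmem ![e]
    simp only [Finset.univ_unique, Fin.default_eq_zero, Finset.prod_singleton,
      Matrix.cons_val_zero, he, mul_one] at h2
    rw [Real.norm_eq_abs, abs_mul, mul_comm]
    exact mul_le_mul h2 h1 (abs_nonneg _) (derivSup_nonneg _)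
  have hhess : ∀ ρ ξ, Summable fun σ => hessForm V κ F e ρ σ (δ ξ σ) := by
    intro ρ ξ
    have h2 : Summable fun σ : Dir d => derivSup V κ ![ρ, σ] * ‖σ.vec‖ := by
      have h := (summable_derivSup_two hV hk).comp_injective
        (i := fun σ : Dir d => (ρ, σ)) (Prod.mk_right_injective ρ)
      have hρ := norm_vec_pos ρ
      refine (h.mul_left ‖ρ.vec‖⁻¹).congr fun q => ?_
      simp only [Function.comp]
      field_simp
    refine Summable.of_norm_bounded (h2.mul_right (2 * κ)) fun σ => ?_
    refine (abs_hessForm_le hκ hV hk hF he ρ σ _).trans ?_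
    have := mul_le_mul_of_nonneg_left (hδb ξ σ) (derivSup_nonneg (V := V) (κ := κ) ![ρ, σ])
    linarith
  have hP : ∀ ρ : Dir d, ∑' σ, ρ.vec α * hessForm V κ F e ρ σ (η ρ σ) =
      ρ.vec α * ∑ ξ ∈ s ρ, chi ζ ξ ρ x * ∑' σ, hessForm V κ F e ρ σ (δ ξ σ) := by
    intro ρ
    rw [tsum_mul_left]
    congr 1
    simp_rw [← tsum_mul_left]
    rw [← Summable.tsum_finsetSum fun ξ _ => (hhess ρ ξ).mul_left _]
    refine tsum_congr fun σ => ?_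
    simp [hη_def, map_sum]
  have hPS : Summable fun ρ : Dir d => ∑' σ, ρ.vec α * hessForm V κ F e ρ σ (η ρ σ) := hTsum.prod
  set r : Dir d → Site d → ℝ := fun ρ ξ => partialDeriv V κ ![ρ] (g ξ) ![e] -
    partialDeriv V κ ![ρ] (homStencil F) ![e] - ∑' σ, hessForm V κ F e ρ σ (δ ξ σ) with hr_def
  have hsplit : ∑' q, atomStressTerm ζ V κ u x i α q -
      ∑' ρ : Dir d, partialDeriv V κ ![ρ] (homStencil F) ![unitMat i α ρ.vec] =
      (∑' q : Dir d × Dir d, q.1.vec α * hessForm V κ F e q.1 q.2 (η q.1 q.2)) +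
        ∑' ρ : Dir d, ρ.vec α * ∑ ξ ∈ s ρ, chi ζ ξ ρ x * r ρ ξ := by
    have e1 : ∀ ρ : Dir d, ρ.vec α * ∑ ξ ∈ s ρ, chi ζ ξ ρ x * r ρ ξ =
        ρ.vec α * (∑ ξ ∈ s ρ, chi ζ ξ ρ x * partialDeriv V κ ![ρ] (g ξ) ![e]) -
        ρ.vec α * partialDeriv V κ ![ρ] (homStencil F) ![e] -
        ∑' σ, ρ.vec α * hessForm V κ F e ρ σ (η ρ σ) := by
      intro ρ
      rw [hP]
      simp only [hr_def, mul_sub, Finset.sum_sub_distrib]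
      rw [← Finset.sum_mul (s ρ) (fun ξ => chi ζ ξ ρ x), hs1, one_mul]
    simp_rw [e1, hunit]
    rw [(hatomS.sub hcbS).tsum_sub hPS, hatomS.tsum_sub hcbS, hatom, hTsum.tsum_prod]
    ring
  -- the quadratic remainder
  have hquad : ‖∑' ρ : Dir d, ρ.vec α * ∑ ξ ∈ s ρ, chi ζ ξ ρ x * r ρ ξ‖ₑ ≤
      ENNReal.ofReal (A ^ 2) * ∑' ρ : Fin 3 → Dir d, msBound V κ ∞ ρ *
        ENNReal.ofReal (N (ρ 0) (ρ 1)) * ENNReal.ofReal (N (ρ 0) (ρ 2)) := by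
    refine enorm_tsum_mul_le_msBound_three hV hk hN0 fun ρ => ?_
    exact enorm_sum_mul_le (s ρ) (c := fun ξ => chi ζ ξ ρ x) (r := r ρ)
      (fun ξ _ => chi_nonneg hζ ξ ρ x) (hs1 ρ) (fun ξ _ h0 =>
        enorm_remainder_le hκ hV hk hF he hA hN0 (hg ξ) ρ fun σ => by
          have := hN ξ ρ σ h0
          rwa [← hδ] at this)
  rw [hsplit, mul_add]
  exact (enorm_add_le _ _).trans (add_le_add hlin hquad)

theorem matNorm_le_sum_abs (S : Matrix (Fin d) (Fin d) ℝ) : matNorm S ≤ ∑ i, ∑ α, |S i α| := by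
  unfold matNorm
  have h0 : 0 ≤ ∑ i, ∑ α, |S i α| :=
    Finset.sum_nonneg fun i _ => Finset.sum_nonneg fun α _ => abs_nonneg _
  rw [Real.sqrt_le_left h0, ← Finset.sum_product', ← Finset.sum_product']
  simp_rw [← sq_abs (S _ _)]
  exact Finset.sum_sq_le_sq_sum_of_nonneg fun q _ => abs_nonneg _

theorem ofReal_matNorm_le {S : Matrix (Fin d) (Fin d) ℝ} {Y : ℝ≥0∞}
    (h : ∀ i α, ‖S i α‖ₑ ≤ Y) : ENNReal.ofReal (matNorm S) ≤ ENNReal.ofReal (d * d) * Y := by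
  refine (ENNReal.ofReal_le_ofReal (matNorm_le_sum_abs S)).trans ?_
  have e : ENNReal.ofReal (∑ i, ∑ α, |S i α|) = ∑ i, ∑ α, ‖S i α‖ₑ :=
    (ENNReal.ofReal_sum_of_nonneg fun i _ => Finset.sum_nonneg fun α _ => abs_nonneg _).trans
      (Finset.sum_congr rfl fun i _ =>
        (ENNReal.ofReal_sum_of_nonneg fun α _ => abs_nonneg _).trans
          (Finset.sum_congr rfl fun α _ => (Real.enorm_eq_ofReal_abs _).symm))
  rw [e]
  refine (Finset.sum_le_sum fun i _ => Finset.sum_le_sum fun α _ => h i α).trans (le_of_eq ?_)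
  rw [ENNReal.ofReal_mul (Nat.cast_nonneg d)]
  simp [mul_assoc]

theorem uniqueDiffWithinAt_gradBall (hκ : 0 < κ) (hF : F ∈ gradBall d κ) :
    UniqueDiffWithinAt ℝ (gradBall d κ) F :=
  uniqueDiffOn_convex (convex_closedBall 0 κ)
    ⟨0, mem_interior_iff_mem_nhds.2 (Metric.closedBall_mem_nhds 0 hκ)⟩ F hF

end Comparison

end CauchyBorn

theorem mainTheorem3 {d : ℕ} (ζ : Space d → ℝ) (hζ : IsNodalBasis ζ) :
    ∃ (C c : ℝ) (ν : Dir d → Dir d → Set (Space d)), 0 < C ∧ 0 < c ∧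
      (∀ ρ σ : Dir d,
        MeasurableSet (ν ρ σ) ∧
        ν ρ σ ⊆ Metric.ball 0 (c * (‖ρ.vec‖ + ‖σ.vec‖)) ∧
        -ν ρ σ = ν ρ σ ∧
        volume (ν ρ σ) ≤
          ENNReal.ofReal (C * (crossNorm ρ.vec σ.vec + ‖ρ.vec‖ + ‖σ.vec‖))) ∧
      ∀ (k : ℕ) (κ : ℝ) (V : Stencil d → EReal), 3 ≤ k → 0 < κ → IsSiteEnergy V κ k →
      ∀ (u : Space d → Space d)
        (G₁ : Space d → Space d →L[ℝ] Space d)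
        (G₂ : Space d → Space d →L[ℝ] Space d →L[ℝ] Space d)
        (G₃ : Space d → Space d →L[ℝ] Space d →L[ℝ] Space d →L[ℝ] Space d),
        IsHomSobolevThree u G₁ G₂ G₃ →
        eLpNorm G₁ ∞ volume ≤ ENNReal.ofReal κ →
      ∀ x : Space d,
        -- both stresses are well defined
        (∀ (ξ : Site d) (ρ : Dir d),
          ‖onLattice u (ξ + ρ.1) - onLattice u ξ‖ ≤ κ * ‖ρ.vec‖) ∧
        (∀ i α : Fin d, Summable (atomStressTerm ζ V κ u x i α)) ∧
        DifferentiableAt ℝ u x ∧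
        fderiv ℝ u x ∈ gradBall d κ ∧
        DifferentiableWithinAt ℝ (fun F => (cbEnergy V F).toReal) (gradBall d κ) (fderiv ℝ u x) ∧
        -- the second-order estimate
        ENNReal.ofReal (matNorm (atomStress ζ V κ u x - cbStress V κ u x)) ≤
          ENNReal.ofReal C *
            ((∑' ρ : Fin 2 → Dir d,
                msBound V κ ∞ ρ * supNormOn G₃ (x +ᵥ ν (ρ 0) (ρ 1))) +
              ∑' ρ : Fin 3 → Dir d,
                msBound V κ ∞ ρ * supNormOn G₂ (x +ᵥ ν (ρ 0) (ρ 1)) *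
                  supNormOn G₂ (x +ᵥ ν (ρ 0) (ρ 2))) := by
  obtain ⟨R, hR0, hR⟩ := hζ.exists_radius
  set vol : ℝ := (volume (Metric.ball (0 : Space d) (R + 1 + 2))).toReal with hvol
  have hvol0 : 0 ≤ vol := ENNReal.toReal_nonneg
  -- the three summands serve the stress estimate, the volume bound and positivity
  set C : ℝ := d * d * (R + 1) ^ 2 + 45 * vol + 1 with hC
  refine ⟨C, R + 2, fun ρ σ => parNhd (R + 1) ρ.vec σ.vec, by positivity, by positivity,
    fun ρ σ => ⟨(isOpen_parNhd _ _ _).measurableSet, ?_, neg_parNhd _ _ _, ?_⟩, ?_⟩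
  · have := parNhd_subset_ball (R := R + 1) (by linarith) (w := σ.vec) (one_le_norm_vec ρ)
    have e : R + 1 + 1 = R + 2 := by ring
    rwa [e] at this
  · refine (volume_parNhd_le (one_le_norm_vec ρ) (one_le_norm_vec σ)).trans
      (ENNReal.ofReal_le_ofReal ?_)
    have h0 : 0 ≤ crossNorm ρ.vec σ.vec := Real.sqrt_nonneg _
    refine mul_le_mul_of_nonneg_right ?_ (by positivity)
    rw [hC]
    nlinarith [mul_nonneg (mul_nonneg (Nat.cast_nonneg (α := ℝ) d) (Nat.cast_nonneg (α := ℝ) d))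
      (sq_nonneg (R + 1))]
  intro k κ V hk hκ hV u G₁ G₂ G₃ hu hG₁ x
  have hlat : ∀ (ξ : Site d) (ρ : Dir d), Site.pt (ξ + ρ.1) = Site.pt ξ + ρ.vec := by
    intro ξ ρ
    ext j
    simp [Site.pt, Dir.vec]
  have hdiff : ∀ (ξ : Site d) (ρ : Dir d),
      ‖onLattice u (ξ + ρ.1) - onLattice u ξ‖ ≤ κ * ‖ρ.vec‖ := by
    intro ξ ρ
    have := hu.norm_image_sub_le hκ hG₁ (Site.pt ξ) (Site.pt ξ + ρ.vec)
    rwa [add_sub_cancel_left, ← hlat] at this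
  obtain ⟨hud, huκ⟩ := hu.norm_fderiv_le hκ hG₁ x
  have hF : fderiv ℝ u x ∈ gradBall d κ := by simpa [gradBall] using huκ
  obtain ⟨L, hL, hLsum⟩ := hasFDerivWithinAt_cbEnergy hκ hV hk hF
  refine ⟨hdiff, fun i α => summable_atomStressTerm hζ hκ hV hk hdiff x i α, hud, hF,
    hL.differentiableWithinAt, ?_⟩
  obtain ⟨H, hH⟩ := hu.exists_taylor x
  have htaylor := fun (ξ : Site d) (ρ σ : Dir d) (h : chi ζ ξ ρ x ≠ 0) =>
    hH R ρ.vec σ.vec (Site.pt ξ) hR0 (one_le_norm_vec ρ) (exists_of_chi_ne_zero hR h)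
  simp only [← hlat] at htaylor
  have hcomp : ∀ i α, ‖(atomStress ζ V κ u x - cbStress V κ u x) i α‖ₑ ≤
      ENNReal.ofReal ((R + 1) ^ 2) *
        ((∑' ρ : Fin 2 → Dir d,
            msBound V κ ∞ ρ * supNormOn G₃ (x +ᵥ parNhd (R + 1) (ρ 0).vec (ρ 1).vec)) +
          ∑' ρ : Fin 3 → Dir d,
            msBound V κ ∞ ρ * supNormOn G₂ (x +ᵥ parNhd (R + 1) (ρ 0).vec (ρ 1).vec) *
              supNormOn G₂ (x +ᵥ parNhd (R + 1) (ρ 0).vec (ρ 2).vec)) := by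
    intro i α
    have := enorm_stress_component_sub_le hζ hκ hV hk hF hdiff (by linarith : 0 ≤ R + 1)
      (N := fun ρ σ => (supNormOn G₂ (x +ᵥ parNhd (R + 1) ρ.vec σ.vec)).toReal)
      (M := fun ρ σ => (supNormOn G₃ (x +ᵥ parNhd (R + 1) ρ.vec σ.vec)).toReal)
      (fun _ _ => ENNReal.toReal_nonneg) (fun ξ ρ σ h => (htaylor ξ ρ σ h).1)
      (fun ξ ρ σ h => (htaylor ξ ρ σ h).2)
      (fun ρ σ => by rw [vec_opp, vec_opp, parNhd_neg_vec]) i α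
    simp only [fun s => ENNReal.ofReal_toReal (a := supNormOn G₂ s) (hu.bdd₂.restrict s).2.ne,
      fun s => ENNReal.ofReal_toReal (a := supNormOn G₃ s) (hu.bdd₃.restrict s).2.ne] at this
    rw [← hLsum, ← hL.fderivWithin (uniqueDiffWithinAt_gradBall hκ hF)] at this
    exact this
  refine (ofReal_matNorm_le hcomp).trans ?_
  rw [← mul_assoc, ← ENNReal.ofReal_mul (by positivity)]
  refine mul_le_mul_left (ENNReal.ofReal_le_ofReal ?_) _
  rw [hC]
  linarith
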